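/- Let $T=(V,E)$ be a finite tree with $n=|V|$ nodes, rooted at an arbitrary node $r$. Let $A\subseteq V$ be a set of $k$ starting nodes, each holding one agent, and let $B\subseteq V$ be a set of $k$ target nodes ($A$ and $B$ may overlap). For a node $u$ let $T_u$ be the subtree rooted at $u$. The following algorithm keeps, for each node $u$, an integer $d(u)$ (initially $d(u)=|B\cap T_u|-|A\cap T_u|$), a list $l(u)$ of times (initially empty) and an integer $s(u)$ (initially $0$); moreover each node may be marked as processed (initially none is). For an empty list, $\max l(u)=0$. A move $(u,v,t)$ means that the agent that is at $u$ at timestep $t$ is at the adjacent node $v$ at timestep $t+1$. **direct_traffic**$(u)$: 1. If $u\in A$, insert $s(u)$ at the start of $l(u)$. 2. For each child $v$ of $u$ with $d(v)<0$, in any order: set $s(v)\leftarrow\max(s(u)-1,\ \max l(u),\ 0)$ and call direct_traffic$(v)$. 3. For each time $t$ in $l(u)$, in the order of the list: call send_agent$(u,t)$. 4. Mark $u$ as processed. 5. For each child $v$ of $u$ that is not yet processed, in any order: call direct_traffic$(v)$. **send_agent**$(u,t)$: - If $d(u)<0$: append $t+1$ to $l(p)$, where $p$ is the parent of $u$, output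 the move $(u,p,t)$ and increase $d(u)$ by $1$. - Otherwise, if $u$ has a child with positive $d$: pick any such child $v$, append $t+1$ to $l(v)$, output the move $(u,v,t)$ and decrease $d(v)$ by $1$. - Otherwise do nothing. The plan is the list of all moves output by direct_traffic$(r)$; an agent waits whenever no listed move leaves its current node at the current timestep. A plan is feasible (for unlabeled multi-agent path finding) if all its moves are along edges, each is listed once and is carried out by an agent, no two agents are ever at the same node at the same time, no two agents swap along an edge in one timestep, and every agent ends at a node of $B$, called its target. The path length of an agent is the number of its move actions plus the number of its wait actions away from its target, and the sum of costs $S$ of a feasible plan is the sum of the path lengths of all agents. **Corollary.** For every tree $T$, root $r$ and sets $A,B$ as above, and for every way of making the arbitrary choices of the algorithm, direct_traffic$(r)$ terminates and its plan is feasible, with sum of costs $$S\le k(n-k).$$ -/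

import Mathlib

open Finset

namespace TreeMAPF

/-- A timed move: an agent leaves the node `src` at timestep `time` along an edge and
is at the node `dst` at timestep `time + 1`. -/
structure Move (V : Type*) where
  src : V
  dst : V
  time : ℕ

/-! ### Plans for unlabeled multi-agent path finding -/

section Plans

variable {V : Type*} [DecidableEq V]

/-- One synchronous step: where an agent that is at `x` at timestep `t` is at timestep `t + 1`.
It follows the move of the plan that leaves `x` at time `t`, and waits if there is none. -/
def stepPos (plan : List (Move V)) (x : V) (t : ℕ) : V :=
  match plan.find? (fun m => decide (m.src = x ∧ m.time = t)) with
  | some m => m.dst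
  | none => x

/-- The position at timestep `t` of the agent that starts at the node `a`. -/
def position (plan : List (Move V)) (a : V) : ℕ → V
  | 0 => a
  | t + 1 => stepPos plan (position plan a t) t

/-- The timestep by which all moves of the plan are completed. -/
def horizon (plan : List (Move V)) : ℕ :=
  (plan.map (fun m => m.time + 1)).foldr max 0

/-- The node at which the agent that starts at `a` ends. In a feasible plan, this is
the target of this agent. -/
def finalNode (plan : List (Move V)) (a : V) : V :=
  position plan a (horizon plan)

/-- A feasible plan for unlabeled MAPF on the graph `G`: agents move along edges, every listed
move is listed once and is carried out by an agent, no two agents are at the same node at the same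
time, no two agents swap along an edge, and every agent ends at a target. -/
structure IsFeasible (G : SimpleGraph V) (starts targets : Finset V) (plan : List (Move V)) :
    Prop where
  nodup : plan.Nodup
  adj : ∀ m ∈ plan, G.Adj m.src m.dst
  executed : ∀ m ∈ plan, ∃ a ∈ starts,
    position plan a m.time = m.src ∧ position plan a (m.time + 1) = m.dst
  no_vertex_conflict : ∀ a ∈ starts, ∀ b ∈ starts, a ≠ b →
    ∀ t, position plan a t ≠ position plan b t
  no_swap_conflict : ∀ a ∈ starts, ∀ b ∈ starts, a ≠ b → ∀ t,
    ¬ (position plan a (t + 1) = position plan b t ∧ position plan b (t + 1) = position plan a t)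
  reaches_target : ∀ a ∈ starts, finalNode plan a ∈ targets

/-- The path length of the agent that starts at `a`: the number of its move actions plus
the number of its wait actions away from its target. -/
def pathLength (plan : List (Move V)) (a : V) : ℕ :=
  #{t ∈ range (horizon plan) |
    position plan a (t + 1) ≠ position plan a t ∨ position plan a t ≠ finalNode plan a}

/-- The sum of costs of a plan: the sum of the path lengths of all agents. -/
def sumOfCosts (starts : Finset V) (plan : List (Move V)) : ℕ :=
  ∑ a ∈ starts, pathLength plan a

end Plans

/-! ### Rooted trees and demands -/

section Rooted

variable {V : Type*}

/-- In the tree `G` rooted at `r`, the node `v` is a child of `u`. -/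
def IsChild (G : SimpleGraph V) (r u v : V) : Prop :=
  G.Adj u v ∧ G.dist r v = G.dist r u + 1

open Classical in
/-- The parent of `u` in the tree `G` rooted at `r` (the value at the root is irrelevant). -/
noncomputable def parent (G : SimpleGraph V) (r u : V) : V :=
  if h : ∃ p, IsChild G r p u then h.choose else u

/-- `v` is a node of the subtree `T_u`, that is, `u` is on the path from `r` to `v`. -/
def InSubtree (G : SimpleGraph V) (r u v : V) : Prop :=
  G.dist r v = G.dist r u + G.dist u v

open Classical in
/-- The initial demand of `u`: the number of targets minus the number of agents in `T_u`. -/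
noncomputable def initialDemand (G : SimpleGraph V) (r : V) (starts targets : Finset V) (u : V) :
    ℤ :=
  (#{v ∈ targets | InSubtree G r u v} : ℤ) - (#{v ∈ starts | InSubtree G r u v} : ℤ)

/-- Termination measure for the recursion over the rooted tree. -/
theorem card_deeper_lt [Fintype V] (G : SimpleGraph V) (r : V) {u v : V}
    (h : IsChild G r u v) :
    #{w : V | G.dist r v < G.dist r w} < #{w : V | G.dist r u < G.dist r w} := by
  have h2 := h.2
  apply Finset.card_lt_card
  rw [Finset.ssubset_iff_of_subset]
  · exact ⟨v, by simp [h2], by simp⟩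
  · intro w hw
    simp only [Finset.mem_filter, Finset.mem_univ, true_and] at hw ⊢
    omega

end Rooted

/-! ### The algorithm -/

/-- The variables of the algorithm: the demands `d`, the lists `l` of times, the earliest
departure times `s`, the set of nodes marked as processed, and the moves output so far. -/
structure State (V : Type*) where
  d : V → ℤ
  l : V → List ℕ
  s : V → ℕ
  processed : Finset V
  output : List (Move V)

section Algorithm

variable {V : Type*} [DecidableEq V]

/-- The maximum of a list of times, with `0` for the empty list. -/
def listMax (l : List ℕ) : ℕ := l.foldr max 0

/-- A resolution of the arbitrary choices of the algorithm. Each choice may depend on the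
whole current state. -/
structure Choices (G : SimpleGraph V) (r : V) where
  /-- the order in which the children of `u` with negative demand are treated -/
  negOrder : State V → V → List V
  negOrder_nodup : ∀ σ u, (negOrder σ u).Nodup
  mem_negOrder : ∀ σ u v, v ∈ negOrder σ u ↔ IsChild G r u v ∧ σ.d v < 0
  /-- the child of `u` with positive demand to which the next agent is sent -/
  pick : State V → V → V
  pick_spec : ∀ σ u, (∃ v, IsChild G r u v ∧ 0 < σ.d v) →
    IsChild G r u (pick σ u) ∧ 0 < σ.d (pick σ u)
  /-- the order in which the children of `u` not yet processed are treated -/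
  restOrder : State V → V → List V
  restOrder_nodup : ∀ σ u, (restOrder σ u).Nodup
  mem_restOrder : ∀ σ u v, v ∈ restOrder σ u ↔ IsChild G r u v ∧ v ∉ σ.processed

/-- Append `t + 1` to `l(w)` and output the move `(u, w, t)`. -/
def State.move (σ : State V) (u w : V) (t : ℕ) : State V :=
  { σ with
    l := Function.update σ.l w (σ.l w ++ [t + 1])
    output := σ.output ++ [⟨u, w, t⟩] }

/-- `d(x) ← d(x) + c`. -/
def State.addDemand (σ : State V) (x : V) (c : ℤ) : State V :=
  { σ with d := Function.update σ.d x (σ.d x + c) }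

open Classical in
/-- The subroutine `send_agent(u, t)`. -/
noncomputable def sendAgent (G : SimpleGraph V) (r : V) (χ : Choices G r) (u : V)
    (σ : State V) (t : ℕ) : State V :=
  if σ.d u < 0 then
    (σ.move u (parent G r u) t).addDemand u 1
  else if ∃ v, IsChild G r u v ∧ 0 < σ.d v then
    (σ.move u (χ.pick σ u) t).addDemand (χ.pick σ u) (-1)
  else σ

/-- `if agent(u) = 1 then insert s(u) at the start of l(u)`. -/
def insertStart (starts : Finset V) (u : V) (σ : State V) : State V :=
  if u ∈ starts then { σ with l := Function.update σ.l u (σ.s u :: σ.l u) } else σ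

/-- `s(v) ← max(s(u) - 1, max l(u), 0)`; the subtraction is truncated at `0`. -/
def setDelay (u v : V) (σ : State V) : State V :=
  { σ with s := Function.update σ.s v (max (σ.s u - 1) (listMax (σ.l u))) }

/-- `for time t in l(u) do send_agent(u, t)`. -/
noncomputable def sendAll (G : SimpleGraph V) (r : V) (χ : Choices G r) (u : V) (σ : State V) :
    State V :=
  (σ.l u).foldl (sendAgent G r χ u) σ

/-- Mark `u` as processed. -/
def markProcessed (u : V) (σ : State V) : State V :=
  { σ with processed := insert u σ.processed }

/-- The recursive algorithm `direct_traffic(u)`. -/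
noncomputable def directTraffic [Fintype V] (G : SimpleGraph V) (r : V) (starts : Finset V)
    (χ : Choices G r) (u : V) (σ : State V) : State V :=
  let σ₁ := insertStart starts u σ
  let σ₂ := (χ.negOrder σ₁ u).attach.foldl
    (fun τ v => directTraffic G r starts χ v.1 (setDelay u v.1 τ)) σ₁
  let σ₃ := markProcessed u (sendAll G r χ u σ₂)
  (χ.restOrder σ₃ u).attach.foldl (fun τ v => directTraffic G r starts χ v.1 τ) σ₃
termination_by #{w : V | G.dist r u < G.dist r w}
decreasing_by
  · exact card_deeper_lt G r ((χ.mem_negOrder _ _ _).1 v.2).1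
  · exact card_deeper_lt G r ((χ.mem_restOrder _ _ _).1 v.2).1

/-- The initial state: demands computed from the input, empty lists, `s = 0`, no node
processed, no output. -/
noncomputable def initialState (G : SimpleGraph V) (r : V) (starts targets : Finset V) :
    State V where
  d := initialDemand G r starts targets
  l := fun _ => []
  s := fun _ => 0
  processed := ∅
  output := []

/-- The plan output by `direct_traffic(r)`. -/
noncomputable def directTrafficPlan [Fintype V] (G : SimpleGraph V) (r : V)
    (starts targets : Finset V) (χ : Choices G r) : List (Move V) :=
  (directTraffic G r starts χ r (initialState G r starts targets)).output

/-- The arbitrary choices can always be resolved. -/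
instance [Fintype V] (G : SimpleGraph V) (r : V) : Nonempty (Choices G r) := by
  classical
  exact ⟨{
    negOrder := fun σ u => (univ.filter (fun v => IsChild G r u v ∧ σ.d v < 0)).toList
    negOrder_nodup := fun σ u => Finset.nodup_toList _
    mem_negOrder := fun σ u v => by simp
    pick := fun σ u => if h : ∃ v, IsChild G r u v ∧ 0 < σ.d v then h.choose else u
    pick_spec := fun σ u h => by
      rw [dif_pos h]
      exact h.choose_spec
    restOrder := fun σ u => (univ.filter (fun v => IsChild G r u v ∧ v ∉ σ.processed)).toList
    restOrder_nodup := fun σ u => Finset.nodup_toList _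
    mem_restOrder := fun σ u v => by simp }⟩

end Algorithm

end TreeMAPF

namespace TreeMAPF

/-! ### Rooted trees -/

section Tree

variable {V : Type*} {G : SimpleGraph V} {r : V}

/-! Once the call for a node `w` is over, `l(w)` increases strictly and consists of the time `s(w)`
of the agent starting at `w` (if any) and of all arrival times at `w`. Its entries are also the
departure times from `w`, except that the last one is left over when `w` is a target. This is
`Done`, and if it holds at every node, the plan can be checked locally. Two simultaneous arrivals
would repeat an entry of `l(w)`, and an arrival where another agent waits would contradict the order
of the list. The sign of the initial demand below an edge fixes the direction in which the edge is
used, so there are no swaps. An agent can only get stuck at a target. All entries are at most n - k,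
hence so are the horizon and each of the k path lengths.

The work is to obtain `Done` by recursion, from the precondition `Ready` and the postcondition
`Post`. The number of entries is flow conservation at `u`. The order comes from the delays: `s(v)`
is at least `max l(u)`, and agents coming out of `T_v` reach `u` only after `s(v)`, so each batch
falls behind the earlier ones.

The time bound is a budget argument. Let N(u) and Z(u) count the non-targets and the non-starts in
`T_u`, and let d₀ be the initial demand; then N = Z - d₀. A call is entered with max(s(u), max l(u))
+ N(u) ≤ n - k, an equality at the root, and treating a child's subtree uses up at most its own N.
This needs a bound on when a subtree of negative demand is emptied of its surplus: its agents reach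
the parent by time max(s(u) - d₀(u), N(u)). The bound follows from the invariant that the j-th entry
t of `l(u)` satisfies t + 1 ≤ max(s(u), Z(u)) + j. The carriers are `foldl_sendAgent_spec`,
`foldl_neg_spec` and `post_of_children`. -/

theorem inSubtree_self (u : V) : InSubtree G r u u := by
  simp [InSubtree]

theorem inSubtree_root (v : V) : InSubtree G r r v := by
  simp [InSubtree]

/-- Shortest walks from the root to `p` and to `q`, prolonged to `v`, are both paths; paths in a
tree are unique, so their penultimate nodes agree. -/
theorem IsChild.parent_unique (hG : G.IsTree) {p q v : V} (hp : IsChild G r p v)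
    (hq : IsChild G r q v) : p = q := by
  obtain ⟨P, hP⟩ := hG.connected.exists_walk_length_eq_dist r p
  obtain ⟨Q, hQ⟩ := hG.connected.exists_walk_length_eq_dist r q
  have hP' : (P.concat hp.1).IsPath := SimpleGraph.Walk.isPath_of_length_eq_dist _ (by
    rw [SimpleGraph.Walk.length_concat, hP, hp.2])
  have hQ' : (Q.concat hq.1).IsPath := SimpleGraph.Walk.isPath_of_length_eq_dist _ (by
    rw [SimpleGraph.Walk.length_concat, hQ, hq.2])
  have h := (hG.isAcyclic.subsingleton_path r v).elim ⟨_, hP'⟩ ⟨_, hQ'⟩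
  have h2 := congrArg (fun w : G.Path r v => w.1.penultimate) h
  simpa using h2

theorem parent_eq (hG : G.IsTree) {p u : V} (h : IsChild G r p u) : parent G r u = p := by
  have hex : ∃ p, IsChild G r p u := ⟨p, h⟩
  rw [parent, dif_pos hex]
  exact hex.choose_spec.parent_unique hG h

theorem exists_isChild_of_ne (hG : G.IsTree) {u : V} (hu : u ≠ r) : ∃ p, IsChild G r p u := by
  obtain ⟨P, hP⟩ := hG.connected.exists_walk_length_eq_dist u r
  cases P with
  | nil => exact absurd rfl hu
  | @cons _ x _ h Q =>
    refine ⟨x, h.symm, ?_⟩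
    have h1 := SimpleGraph.dist_le Q
    have h2 := hG.connected.dist_triangle (u := r) (v := x) (w := u)
    have h3 : G.dist x u = 1 := SimpleGraph.dist_eq_one_iff_adj.2 h.symm
    rw [SimpleGraph.Walk.length_cons] at hP
    rw [G.dist_comm (u := r) (v := x), G.dist_comm (u := r) (v := u)] at *
    omega

theorem IsChild.ne {u v : V} (h : IsChild G r u v) : u ≠ v := h.1.ne

theorem IsChild.inSubtree {u v : V} (h : IsChild G r u v) : InSubtree G r u v := by
  have h3 : G.dist u v = 1 := SimpleGraph.dist_eq_one_iff_adj.2 h.1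
  rw [InSubtree, h3, h.2]

theorem InSubtree.dist_le {u v : V} (h : InSubtree G r u v) : G.dist r u ≤ G.dist r v := by
  rw [h]; exact Nat.le_add_right _ _

theorem IsChild.not_inSubtree {u v : V} (h : IsChild G r u v) : ¬ InSubtree G r v u := by
  intro h2
  have := h2.dist_le
  have := h.2
  omega

theorem InSubtree.of_child (hG : G.IsTree) {u c v : V} (hc : IsChild G r u c)
    (h : InSubtree G r c v) : InSubtree G r u v := by
  have h1 := hc.inSubtree
  unfold InSubtree at *
  have h2 := hG.connected.dist_triangle (u := u) (v := c) (w := v)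
  have h3 := hG.connected.dist_triangle (u := r) (v := u) (w := v)
  omega

theorem InSubtree.ne_of_child {u c v : V} (hc : IsChild G r u c)
    (h : InSubtree G r c v) : v ≠ u := by
  rintro rfl
  exact hc.not_inSubtree h

theorem InSubtree.exists_child (hG : G.IsTree) {u v : V} (h : InSubtree G r u v) (hne : v ≠ u) :
    ∃ c, IsChild G r u c ∧ InSubtree G r c v := by
  obtain ⟨P, hP⟩ := hG.connected.exists_walk_length_eq_dist u v
  cases P with
  | nil => exact absurd rfl hne
  | @cons _ x _ hx Q =>
    have h1 := SimpleGraph.dist_le Q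
    have h2 := hG.connected.dist_triangle (u := r) (v := u) (w := x)
    have h3 : G.dist u x = 1 := SimpleGraph.dist_eq_one_iff_adj.2 hx
    have h4 := hG.connected.dist_triangle (u := r) (v := x) (w := v)
    rw [SimpleGraph.Walk.length_cons] at hP
    unfold InSubtree at *
    exact ⟨x, ⟨hx, by omega⟩, by omega⟩

theorem InSubtree.eq_of_dist_eq (hG : G.IsTree) {c c' v : V} (h : InSubtree G r c v)
    (h' : InSubtree G r c' v) (hd : G.dist r c = G.dist r c') : c = c' := by
  -- Climb from `v` towards `c` and `c'`: both climbs use the unique parent, and they last equally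
  -- long.
  have key : ∀ n, ∀ v, G.dist c v = n → InSubtree G r c v → InSubtree G r c' v → c = c' := by
    intro n
    induction n with
    | zero =>
      intro v hv h h'
      unfold InSubtree at *
      rw [hG.connected.dist_eq_zero_iff.1 hv]
      exact (hG.connected.dist_eq_zero_iff.1 (by omega : G.dist c' v = 0)).symm
    | succ n ih =>
      have step : ∀ b w, G.dist b w = n + 1 → InSubtree G r b w →
          ∃ x, IsChild G r x w ∧ InSubtree G r b x ∧ G.dist b x = n := by
        intro b w hb hbw
        obtain ⟨P, hP⟩ := hG.connected.exists_walk_length_eq_dist w b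
        rw [G.dist_comm] at hP
        cases P with
        | nil => simp at hb
        | @cons _ x _ hx Q =>
          have h1 := SimpleGraph.dist_le Q
          have h2 := hG.connected.dist_triangle (u := r) (v := x) (w := w)
          have h3 : G.dist x w = 1 := SimpleGraph.dist_eq_one_iff_adj.2 hx.symm
          have h4 := hG.connected.dist_triangle (u := r) (v := b) (w := x)
          rw [SimpleGraph.Walk.length_cons] at hP
          rw [G.dist_comm (u := x) (v := b)] at h1
          unfold InSubtree at *
          exact ⟨x, ⟨hx.symm, by omega⟩, by omega, by omega⟩
      intro v hv h h'
      obtain ⟨x, hx, hbx, hdx⟩ := step c v hv h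
      obtain ⟨y, hy, hby, -⟩ := step c' v (by unfold InSubtree at *; omega) h'
      obtain rfl := hx.parent_unique hG hy
      exact ih x hdx hbx hby
  exact key _ v rfl h h'

theorem IsChild.eq_of_inSubtree (hG : G.IsTree) {u c c' v : V} (hc : IsChild G r u c)
    (hc' : IsChild G r u c') (h : InSubtree G r c v) (h' : InSubtree G r c' v) : c = c' :=
  h.eq_of_dist_eq hG h' (by rw [hc.2, hc'.2])

/-! ### Children and counting in subtrees -/

open Classical in
/-- The set of children of `u`. -/
noncomputable def children [Fintype V] (G : SimpleGraph V) (r u : V) : Finset V :=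
  {v | IsChild G r u v}

@[simp] theorem mem_children [Fintype V] {u v : V} : v ∈ children G r u ↔ IsChild G r u v := by
  simp [children]

open Classical in
/-- The number of nodes of `S` in the subtree of `u`. -/
noncomputable def countIn (G : SimpleGraph V) (r : V) (S : Finset V) (u : V) : ℕ :=
  #{v ∈ S | InSubtree G r u v}

theorem countIn_root (S : Finset V) : countIn G r S r = #S := by
  classical
  rw [countIn, Finset.filter_true_of_mem fun v _ => inSubtree_root v]

theorem initialDemand_eq (starts targets : Finset V) (u : V) :
    initialDemand G r starts targets u =
      (countIn G r targets u : ℤ) - countIn G r starts u := rfl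

theorem countIn_add_countIn_compl [Fintype V] [DecidableEq V] (S : Finset V) (u : V) :
    countIn G r S u + countIn G r Sᶜ u = countIn G r univ u := by
  classical
  unfold countIn
  rw [← Finset.union_compl S, Finset.filter_union, Finset.card_union_of_disjoint]
  exact Finset.disjoint_filter_filter disjoint_compl_right

/-- `T_u` is the disjoint union of the node `u` and the subtrees of its children. Applied to
targets, starts and their complements, this yields the recursions for d₀, N and Z. -/
theorem countIn_eq [Fintype V] [DecidableEq V] (hG : G.IsTree) (S : Finset V) (u : V) :
    countIn G r S u = (if u ∈ S then 1 else 0) + ∑ c ∈ children G r u, countIn G r S c := by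
  classical
  have h1 : ({v ∈ S | InSubtree G r u v} : Finset V) =
      {v ∈ S | v = u} ∪ (children G r u).biUnion fun c => {v ∈ S | InSubtree G r c v} := by
    ext v
    simp only [mem_filter, mem_union, mem_biUnion, mem_children]
    constructor
    · rintro ⟨hv, h⟩
      by_cases hvu : v = u
      · exact Or.inl ⟨hv, hvu⟩
      · obtain ⟨c, hc, hcv⟩ := h.exists_child hG hvu
        exact Or.inr ⟨c, hc, hv, hcv⟩
    · rintro (⟨hv, rfl⟩ | ⟨c, hc, hv, hcv⟩)
      · exact ⟨hv, inSubtree_self _⟩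
      · exact ⟨hv, hcv.of_child hG hc⟩
  have h2 : #{v ∈ S | v = u} = if u ∈ S then 1 else 0 := by
    rw [Finset.filter_eq']
    split_ifs <;> simp
  unfold countIn
  rw [h1, Finset.card_union_of_disjoint, Finset.card_biUnion, h2]
  · intro c hc c' hc' hne
    rw [Function.onFun, Finset.disjoint_left]
    intro v hv hv'
    simp only [mem_filter] at hv hv'
    exact hne ((mem_children.1 hc).eq_of_inSubtree hG (mem_children.1 hc') hv.2 hv'.2)
  · rw [Finset.disjoint_left]
    intro v hv hv'
    simp only [mem_filter, mem_biUnion, mem_children] at hv hv'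
    obtain ⟨c, hc, -, hcv⟩ := hv'
    exact hcv.ne_of_child hc hv.2

end Tree

/-! ### Local views of states -/

section Views

variable {V : Type*} [DecidableEq V]

/-- The moves output so far that leave `w`. -/
def outMoves (σ : State V) (w : V) : List (Move V) :=
  σ.output.filter fun m => decide (m.src = w)

/-- The arrival times at `w` of the moves output so far. -/
def arrivals (σ : State V) (w : V) : List ℕ :=
  (σ.output.filter fun m => decide (m.dst = w)).map fun m => m.time + 1

/-- At the node `w`, passing from the state `σ` to the state `τ` adds `δ` to the demand, outputs
the moves `mv` leaving `w`, and lets agents arrive at the times `new`; nothing else changes. -/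
structure Evolve (σ τ : State V) (w : V) (δ : ℤ) (mv : List (Move V)) (new : List ℕ) :
    Prop where
  d : τ.d w = σ.d w + δ
  s : τ.s w = σ.s w
  processed : w ∈ τ.processed ↔ w ∈ σ.processed
  out : outMoves τ w = outMoves σ w ++ mv
  l : τ.l w = σ.l w ++ new
  arr : arrivals τ w = arrivals σ w ++ new

/-- The states `σ` and `τ` agree at the node `w`. -/
abbrev Same (σ τ : State V) (w : V) : Prop := Evolve σ τ w 0 [] []

theorem Evolve.refl (σ : State V) (w : V) : Same σ σ w := by
  constructor <;> simp

theorem Evolve.trans {ρ σ τ : State V} {w : V} {δ ε : ℤ} {m n : List (Move V)} {a b : List ℕ}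
    (h : Evolve ρ σ w δ m a) (h' : Evolve σ τ w ε n b) :
    Evolve ρ τ w (δ + ε) (m ++ n) (a ++ b) where
  d := by rw [h'.d, h.d, add_assoc]
  s := by rw [h'.s, h.s]
  processed := by rw [h'.processed, h.processed]
  out := by rw [h'.out, h.out, List.append_assoc]
  l := by rw [h'.l, h.l, List.append_assoc]
  arr := by rw [h'.arr, h.arr, List.append_assoc]

theorem Evolve.same_trans {ρ σ τ : State V} {w : V} {δ : ℤ} {m : List (Move V)} {a : List ℕ}
    (h : Same ρ σ w) (h' : Evolve σ τ w δ m a) : Evolve ρ τ w δ m a := by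
  simpa using h.trans h'

theorem Evolve.trans_same {ρ σ τ : State V} {w : V} {δ : ℤ} {m : List (Move V)} {a : List ℕ}
    (h : Evolve ρ σ w δ m a) (h' : Same σ τ w) : Evolve ρ τ w δ m a := by
  simpa using h.trans h'

theorem evolve_move_addDemand (σ : State V) (u x y : V) (t : ℕ) (c : ℤ) (w : V) :
    Evolve σ ((σ.move u x t).addDemand y c) w (if w = y then c else 0)
      (if w = u then [⟨u, x, t⟩] else []) (if w = x then [t + 1] else []) where
  d := by
    by_cases h : w = y
    · subst h; simp [State.move, State.addDemand]
    · simp [State.move, State.addDemand, h]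
  s := rfl
  processed := Iff.rfl
  out := by
    by_cases h : w = u
    · subst h; simp [State.move, State.addDemand, outMoves, List.filter_append]
    · simp [State.move, State.addDemand, outMoves, List.filter_append, h, Ne.symm h]
  l := by
    by_cases h : w = x
    · subst h; simp [State.move, State.addDemand]
    · simp [State.move, State.addDemand, h]
  arr := by
    by_cases h : w = x
    · subst h; simp [State.move, State.addDemand, arrivals, List.filter_append]
    · simp [State.move, State.addDemand, arrivals, List.filter_append, h, Ne.symm h]

theorem setDelay_same (σ : State V) {u v w : V} (h : w ≠ v) : Same σ (setDelay u v σ) w := by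
  constructor <;> simp [setDelay, h, outMoves, arrivals]

theorem markProcessed_same (σ : State V) {u w : V} (h : w ≠ u) :
    Same σ (markProcessed u σ) w := by
  constructor <;> simp [markProcessed, h, outMoves, arrivals]

theorem insertStart_same (starts : Finset V) (σ : State V) {u w : V} (h : w ≠ u) :
    Same σ (insertStart starts u σ) w := by
  unfold insertStart
  split_ifs
  · constructor <;> simp [h, outMoves, arrivals]
  · exact Evolve.refl _ _

end Views

/-! ### Lists of times -/

theorem le_listMax {l : List ℕ} {t : ℕ} (h : t ∈ l) : t ≤ listMax l := by
  induction l with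
  | nil => simp at h
  | cons a l ih =>
    simp only [listMax, List.foldr_cons] at ih ⊢
    rcases List.mem_cons.1 h with rfl | h
    · exact le_max_left _ _
    · exact (ih h).trans (le_max_right _ _)

theorem listMax_le {l : List ℕ} {m : ℕ} (h : ∀ t ∈ l, t ≤ m) : listMax l ≤ m := by
  induction l with
  | nil => simp [listMax]
  | cons a l ih =>
    simp only [listMax, List.foldr_cons] at ih ⊢
    exact max_le (h a (by simp)) (ih fun t ht => h t (by simp [ht]))

theorem listMax_append (a b : List ℕ) : listMax (a ++ b) = max (listMax a) (listMax b) := by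
  apply le_antisymm
  · apply listMax_le
    intro t ht
    rcases List.mem_append.1 ht with h | h
    · exact (le_listMax h).trans (le_max_left _ _)
    · exact (le_listMax h).trans (le_max_right _ _)
  · apply max_le <;> apply listMax_le <;> intro t ht <;> apply le_listMax <;> simp [ht]

/-- In a strictly increasing list, a bound on the last entry yields a bound on each prefix. -/
theorem prefix_bound {C : ℕ} {a b : List ℕ} (hs : (a ++ b).Pairwise (· < ·))
    (h : ∀ t ∈ a ++ b, t + 1 ≤ C + (a ++ b).length) : ∀ t ∈ a, t + 1 ≤ C + a.length := by
  induction b using List.reverseRecOn with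
  | nil => simpa using h
  | append_singleton b x ih =>
    rw [← List.append_assoc] at hs h
    refine ih (List.pairwise_append.1 hs).1 fun t ht => ?_
    -- Dropping the last entry shortens the list by one and, by strict increase, lowers the bound on
    -- the times by at least one.
    have h1 := (List.pairwise_append.1 hs).2.2 t ht x (by simp)
    have h2 := h x (by simp)
    rw [List.length_append, List.length_singleton] at h2
    omega

/-! ### Sending the agents -/

section Send

variable {V : Type*} [DecidableEq V] {G : SimpleGraph V} {r : V}

theorem foldl_sendAgent_idle (χ : Choices G r) (u : V) (ρ : State V) (h0 : ρ.d u = 0)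
    (hc : ∀ c, IsChild G r u c → ρ.d c = 0) (ts : List ℕ) :
    ts.foldl (sendAgent G r χ u) ρ = ρ := by
  induction ts with
  | nil => rfl
  | cons t ts ih =>
    have : sendAgent G r χ u ρ t = ρ := by
      unfold sendAgent
      rw [if_neg (by omega), if_neg]
      rintro ⟨v, hv, hv'⟩
      have := hc v hv
      omega
    rw [List.foldl_cons, this, ih]

/-- The times are dealt out in order: the first `-ρ.d u` to the parent, the next ones to children of
positive demand, and the last `e` to nobody. The length equation is flow conservation at `u` and
forces exactly `e` to be left over. The list `dn c` holds the arrival times at `c`; as a sublist of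
the shifted departure times it stays sorted whatever `pick` chooses. -/
theorem foldl_sendAgent_spec [Fintype V] (hG : G.IsTree) (χ : Choices G r) (u : V) (ts : List ℕ) :
    ∀ (ρ : State V) (e : ℕ), ρ.d u ≤ 0 → (∀ c, IsChild G r u c → 0 ≤ ρ.d c) →
    (ρ.d u < 0 → ∃ p, IsChild G r p u) →
    (ts.length : ℤ) = -ρ.d u + ∑ c ∈ children G r u, ρ.d c + e →
    ∃ (mv : List (Move V)) (rest : List ℕ) (dn : V → List ℕ),
      mv.map Move.time ++ rest = ts ∧ rest.length = e ∧
      (∀ m ∈ mv, m.src = u ∧ (IsChild G r m.dst u ∧ ρ.d u < 0 ∨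
        IsChild G r u m.dst ∧ 0 < ρ.d m.dst)) ∧
      Evolve ρ (ts.foldl (sendAgent G r χ u) ρ) u (-ρ.d u) mv [] ∧
      (∀ c, IsChild G r u c →
        (dn c).Sublist (mv.map fun m => m.time + 1) ∧ ((dn c).length : ℤ) = ρ.d c ∧
        Evolve ρ (ts.foldl (sendAgent G r χ u) ρ) c (-ρ.d c) [] (dn c)) ∧
      (∀ p, IsChild G r p u →
        Evolve ρ (ts.foldl (sendAgent G r χ u) ρ) p 0 []
          ((ts.take (-ρ.d u).toNat).map (· + 1))) ∧
      (∀ w, w ≠ u → ¬ IsChild G r u w → ¬ IsChild G r w u →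
        Same ρ (ts.foldl (sendAgent G r χ u) ρ) w) := by
  induction ts with
  | nil =>
    intro ρ e hu hc _ hlen
    have hsum : 0 ≤ ∑ c ∈ children G r u, ρ.d c :=
      Finset.sum_nonneg fun c h => hc c (mem_children.1 h)
    simp only [List.length_nil, Nat.cast_zero] at hlen
    have h0 : ρ.d u = 0 := by omega
    have hs0 : ∑ c ∈ children G r u, ρ.d c = 0 := by omega
    have hc0 : ∀ c, IsChild G r u c → ρ.d c = 0 := fun c h =>
      (Finset.sum_eq_zero_iff_of_nonneg fun c h => hc c (mem_children.1 h)).1 hs0 c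
        (mem_children.2 h)
    refine ⟨[], [], fun _ => [], by simp, by simp; omega, by simp, ?_, ?_, ?_, ?_⟩
    · simpa [h0] using Evolve.refl ρ u
    · intro c h
      simpa [hc0 c h] using Evolve.refl ρ c
    · intro p _
      simpa using Evolve.refl ρ p
    · intro w _ _ _
      exact Evolve.refl ρ w
  | cons t ts ih =>
    intro ρ e hu hc hp hlen
    rw [List.length_cons, Nat.cast_add, Nat.cast_one] at hlen
    rw [List.foldl_cons]
    by_cases h1 : ρ.d u < 0
    · obtain ⟨p, hpu⟩ := hp h1
      have hne := hpu.ne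
      have hstep : sendAgent G r χ u ρ t = (ρ.move u p t).addDemand u 1 := by
        rw [sendAgent, if_pos h1, parent_eq hG hpu]
      have hE := evolve_move_addDemand ρ u p u t 1
      rw [hstep]
      set ρ₁ := (ρ.move u p t).addDemand u 1
      have hdu : ρ₁.d u = ρ.d u + 1 := by simpa using (hE u).d
      have hdc : ∀ c, IsChild G r u c → ρ₁.d c = ρ.d c := fun c h => by
        simpa [h.ne.symm] using (hE c).d
      obtain ⟨mv, rest, dn, e1, e2, e3, e4, e5, e6, e7⟩ := ih ρ₁ e (by omega)
        (fun c h => by rw [hdc c h]; exact hc c h) (fun _ => ⟨p, hpu⟩) (by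
          have hs : ∑ c ∈ children G r u, ρ₁.d c = ∑ c ∈ children G r u, ρ.d c :=
            Finset.sum_congr rfl fun c h => hdc c (mem_children.1 h)
          omega)
      refine ⟨⟨u, p, t⟩ :: mv, rest, dn, by simp [e1], e2, ?_, ?_, ?_, ?_, ?_⟩
      · intro m hm
        rcases List.mem_cons.1 hm with rfl | hm
        · exact ⟨rfl, Or.inl ⟨hpu, h1⟩⟩
        · obtain ⟨hs, ⟨h, -⟩ | ⟨h, h'⟩⟩ := e3 m hm
          · exact ⟨hs, Or.inl ⟨h, h1⟩⟩
          · exact ⟨hs, Or.inr ⟨h, by rwa [hdc _ h] at h'⟩⟩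
      · have := (hE u).trans e4
        rw [hdu] at this
        simpa [hne.symm] using this
      · intro c h
        obtain ⟨f1, f2, f3⟩ := e5 c h
        refine ⟨?_, by rw [f2, hdc c h], ?_⟩
        · rw [List.map_cons]
          exact f1.trans (List.sublist_cons_self _ _)
        · have := (hE c).trans f3
          have hcp : c ≠ p := by
            rintro rfl
            have := h.2
            have := hpu.2
            omega
          simpa [h.ne.symm, hcp, hdc c h] using this
      · intro q hq
        obtain rfl := hq.parent_unique hG hpu
        have := (hE q).trans (e6 q hpu)
        have hn : (-ρ.d u).toNat = (-ρ₁.d u).toNat + 1 := by omega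
        rw [hn]
        simpa [hne] using this
      · intro w hw hw1 hw2
        have := (hE w).trans (e7 w hw hw1 hw2)
        have hwp : w ≠ p := by
          rintro rfl
          exact hw2 hpu
        simpa [hw, hwp] using this
    · have h0 : ρ.d u = 0 := by omega
      by_cases h2 : ∃ v, IsChild G r u v ∧ 0 < ρ.d v
      · have hstep : sendAgent G r χ u ρ t =
            (ρ.move u (χ.pick ρ u) t).addDemand (χ.pick ρ u) (-1) := by
          rw [sendAgent, if_neg h1, if_pos h2]
        obtain ⟨hv, hv0⟩ := χ.pick_spec ρ u h2
        rw [hstep]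
        set v := χ.pick ρ u
        have hne := hv.ne
        have hE := evolve_move_addDemand ρ u v v t (-1)
        set ρ₁ := (ρ.move u v t).addDemand v (-1)
        have hdu : ρ₁.d u = 0 := by simpa [hne, h0] using (hE u).d
        have hdc : ∀ c, ρ₁.d c = ρ.d c + if c = v then -1 else 0 := fun c => (hE c).d
        obtain ⟨mv, rest, dn, e1, e2, e3, e4, e5, e6, e7⟩ := ih ρ₁ e (by omega)
          (fun c h => by
            have := hc c h
            rw [hdc c]
            split_ifs with hcv
            · subst hcv; omega
            · omega) (fun h => by omega) (by
            rw [Finset.sum_congr rfl fun c _ => hdc c, Finset.sum_add_distrib,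
              Finset.sum_ite_eq' (children G r u) v, if_pos (mem_children.2 hv)]
            omega)
        refine ⟨⟨u, v, t⟩ :: mv, rest, fun c => (if c = v then [t + 1] else []) ++ dn c,
          by simp [e1], e2, ?_, ?_, ?_, ?_, ?_⟩
        · intro m hm
          rcases List.mem_cons.1 hm with rfl | hm
          · exact ⟨rfl, Or.inr ⟨hv, hv0⟩⟩
          · obtain ⟨hs, ⟨h, h'⟩ | ⟨h, h'⟩⟩ := e3 m hm
            · omega
            · refine ⟨hs, Or.inr ⟨h, ?_⟩⟩
              rw [hdc] at h'
              split_ifs at h' <;> omega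
        · have := (hE u).trans e4
          rw [hdu] at this
          rw [h0]
          simpa [hne] using this
        · intro c h
          obtain ⟨f1, f2, f3⟩ := e5 c h
          have := (hE c).trans f3
          rw [hdc] at f2 this
          refine ⟨?_, ?_, ?_⟩
          · rw [List.map_cons]
            by_cases hcv : c = v
            · simpa [hcv] using hcv ▸ f1
            · simpa [hcv] using f1.trans (List.sublist_cons_self _ _)
          · rw [List.length_append, Nat.cast_add, f2]
            split_ifs <;> simp
          · have hδ : ((if c = v then -1 else 0) + -(ρ.d c + if c = v then -1 else 0) : ℤ) =
                -ρ.d c := by ring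
            rw [hδ] at this
            simpa [h.ne.symm] using this
        · intro p hpu
          have := (hE p).trans (e6 p hpu)
          have hpv : p ≠ v := by
            rintro rfl
            have := hv.2
            have := hpu.2
            omega
          simpa [hdu, h0, hpv, hpu.ne] using this
        · intro w hw hw1 hw2
          have := (hE w).trans (e7 w hw hw1 hw2)
          have hwv : w ≠ v := by
            rintro rfl
            exact hw1 hv
          simpa [hw, hwv] using this
      · have hc0 : ∀ c, IsChild G r u c → ρ.d c = 0 := fun c h => by
          by_contra hne
          exact h2 ⟨c, h, lt_of_le_of_ne (hc c h) (Ne.symm hne)⟩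
        have hsum : ∑ c ∈ children G r u, ρ.d c = 0 :=
          Finset.sum_eq_zero fun c h => hc0 c (mem_children.1 h)
        have hidle := foldl_sendAgent_idle χ u ρ h0 hc0 (t :: ts)
        rw [List.foldl_cons] at hidle
        rw [hidle]
        refine ⟨[], t :: ts, fun _ => [], by simp, by simp; omega, by simp, ?_, ?_, ?_, ?_⟩
        · simpa [h0] using Evolve.refl ρ u
        · intro c h
          simpa [hc0 c h] using Evolve.refl ρ c
        · intro p _
          simpa [h0] using Evolve.refl ρ p
        · intro w _ _ _
          exact Evolve.refl ρ w

end Send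

/-! ### Specification of the recursive calls -/

section Spec

variable {V : Type*} [Fintype V] [DecidableEq V] (G : SimpleGraph V) (r : V)
  (starts targets : Finset V)

/-- A move has the direction prescribed by the initial demands: upwards out of a subtree with
negative demand, or downwards into a subtree with positive demand. -/
def FollowsDemand (m : Move V) : Prop :=
  IsChild G r m.dst m.src ∧ initialDemand G r starts targets m.src < 0 ∨
    IsChild G r m.src m.dst ∧ 0 < initialDemand G r starts targets m.dst

/-- The node `w` has not been touched yet. -/
structure Fresh (σ : State V) (w : V) : Prop where
  d : σ.d w = initialDemand G r starts targets w
  l : σ.l w = []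
  s : σ.s w = 0
  out : outMoves σ w = []
  arr : arrivals σ w = []
  processed : w ∉ σ.processed

/-- The call for `w` is complete. The list `l(w)` consists of the departure time of the starting
agent and of the arrival times; an agent leaves at each of these times, except that the
last one stays at `w` if `w` is a target. -/
structure Done (σ : State V) (w : V) : Prop where
  d : σ.d w = 0
  processed : w ∈ σ.processed
  sorted : (σ.l w).Pairwise (· < ·)
  bound : ∀ t ∈ σ.l w, t ≤ #targetsᶜ
  arr : σ.l w = (if w ∈ starts then [σ.s w] else []) ++ arrivals σ w
  out : ∃ rest, (outMoves σ w).map Move.time ++ rest = σ.l w ∧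
    rest.length = if w ∈ targets then 1 else 0
  dir : ∀ m ∈ outMoves σ w, FollowsDemand G r starts targets m

/-- The precondition of a call for `u`. -/
structure Ready (σ : State V) (u : V) : Prop where
  fresh : ∀ w, InSubtree G r u w → w ≠ u → Fresh G r starts targets σ w
  processed : u ∉ σ.processed
  out : outMoves σ u = []
  arr : arrivals σ u = σ.l u
  d : σ.d u = min (initialDemand G r starts targets u) 0
  len : ((σ.l u).length : ℤ) = max (initialDemand G r starts targets u) 0
  sorted : (σ.l u).Pairwise (· < ·)
  s_lt : ∀ t ∈ σ.l u, σ.s u < t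
  bound : max (σ.s u) (listMax (σ.l u)) + countIn G r targetsᶜ u ≤ #targetsᶜ

/-- The postcondition of a call for `u` that leads from the state `σ` to the state `σ'`:
the times `new` are those at which agents arrive at the parent of `u`. -/
structure Post (σ : State V) (u : V) (σ' : State V) (new : List ℕ) : Prop where
  done : ∀ w, InSubtree G r u w → Done G r starts targets σ' w
  sorted : new.Pairwise (· < ·)
  len : (new.length : ℤ) = max (-initialDemand G r starts targets u) 0
  s_lt : ∀ t ∈ new, σ.s u < t
  bound : ∀ t ∈ new,
    (t : ℤ) ≤ max (σ.s u - initialDemand G r starts targets u) (countIn G r targetsᶜ u)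
  parent : ∀ p, IsChild G r p u → Evolve σ σ' p 0 [] new
  same : ∀ w, ¬ InSubtree G r u w → ¬ IsChild G r w u → Same σ σ' w

variable {G r starts targets}

omit [Fintype V] in
theorem Fresh.of_same {σ τ : State V} {w : V} (h : Fresh G r starts targets σ w)
    (hs : Same σ τ w) : Fresh G r starts targets τ w where
  d := by rw [hs.d, h.d, add_zero]
  l := by rw [hs.l, h.l, List.append_nil]
  s := by rw [hs.s, h.s]
  out := by rw [hs.out, h.out, List.append_nil]
  arr := by rw [hs.arr, h.arr, List.append_nil]
  processed := by rw [hs.processed]; exact h.processed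

theorem Done.of_same {σ τ : State V} {w : V} (h : Done G r starts targets σ w)
    (hs : Same σ τ w) : Done G r starts targets τ w := by
  have hl : τ.l w = σ.l w := by rw [hs.l, List.append_nil]
  have ho : outMoves τ w = outMoves σ w := by rw [hs.out, List.append_nil]
  have ha : arrivals τ w = arrivals σ w := by rw [hs.arr, List.append_nil]
  constructor
  · rw [hs.d, h.d, add_zero]
  · rw [hs.processed]; exact h.processed
  · rw [hl]; exact h.sorted
  · rw [hl]; exact h.bound
  · rw [hl, ha, hs.s]; exact h.arr
  · rw [hl, ho]; exact h.out
  · rw [ho]; exact h.dir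

theorem Ready.of_same {σ τ : State V} {u : V} (h : Ready G r starts targets σ u)
    (hs : ∀ w, InSubtree G r u w → Same σ τ w) : Ready G r starts targets τ u := by
  have hu := hs u (inSubtree_self u)
  have hl : τ.l u = σ.l u := by rw [hu.l, List.append_nil]
  constructor
  · exact fun w hw hne => (h.fresh w hw hne).of_same (hs w hw)
  · rw [hu.processed]; exact h.processed
  · rw [hu.out, h.out, List.append_nil]
  · rw [hu.arr, hl, List.append_nil, h.arr]
  · rw [hu.d, h.d, add_zero]
  · rw [hl, h.len]
  · rw [hl]; exact h.sorted
  · rw [hl, hu.s]; exact h.s_lt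
  · rw [hl, hu.s]; exact h.bound

/-- Both sides count `T_u`, split once by targets and once by starts. In particular a surplus `-d₀`
is at most N, so the non-targets of a subtree can pay for the agents leaving it. -/
theorem countIn_compl_targets (starts targets : Finset V) (u : V) :
    (countIn G r targetsᶜ u : ℤ) =
      countIn G r startsᶜ u - initialDemand G r starts targets u := by
  have h1 := countIn_add_countIn_compl (G := G) (r := r) starts u
  have h2 := countIn_add_countIn_compl (G := G) (r := r) targets u
  rw [initialDemand_eq]
  omega

/-- The loop over the children with negative demand. The number `K` stands for the nodes that
are to be visited after the loop. -/
theorem foldl_neg_spec (hG : G.IsTree) (u : V) (f : V → State V → State V)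
    (hf : ∀ v, IsChild G r u v → ∀ σ, Ready G r starts targets σ v →
      ∃ new, Post G r starts targets σ v (f v σ) new) (K : ℕ) (L : List V) :
    ∀ τ : State V, L.Nodup →
    (∀ v ∈ L, IsChild G r u v ∧ initialDemand G r starts targets v < 0) →
    (∀ v ∈ L, ∀ w, InSubtree G r v w → Fresh G r starts targets τ w) →
    (τ.l u).Pairwise (· < ·) →
    max (τ.s u - 1) (listMax (τ.l u)) + K + (L.map (countIn G r targetsᶜ)).sum ≤ #targetsᶜ →
    ∃ (τ' : State V) (new : List ℕ),
      L.foldl (fun ρ v => f v (setDelay u v ρ)) τ = τ' ∧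
      Evolve τ τ' u 0 [] new ∧
      (new.length : ℤ) = (L.map fun v => -initialDemand G r starts targets v).sum ∧
      (τ'.l u).Pairwise (· < ·) ∧
      (∀ t ∈ new, τ.s u ≤ t) ∧
      max (τ.s u - 1) (listMax (τ'.l u)) + K ≤ #targetsᶜ ∧
      (∀ C, (∀ v ∈ L, countIn G r startsᶜ v + 1 ≤ C + (τ.l u).length) →
        max (τ.s u - 1) (listMax (τ.l u)) + 1 ≤ C + (τ.l u).length →
        max (τ.s u - 1) (listMax (τ'.l u)) + 1 ≤ C + (τ'.l u).length) ∧
      (∀ v ∈ L, ∀ w, InSubtree G r v w → Done G r starts targets τ' w) ∧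
      (∀ w, w ≠ u → (∀ v ∈ L, ¬ InSubtree G r v w) → Same τ τ' w) := by
  induction L with
  | nil =>
    intro τ _ _ _ hs hb
    exact ⟨τ, [], rfl, Evolve.refl _ _, by simp, hs, by simp, by simpa using hb,
      fun C _ h => h, by simp, fun w _ _ => Evolve.refl _ _⟩
  | cons v L ih =>
    intro τ hnd hL hfr hs hb
    rw [List.nodup_cons] at hnd
    rw [List.map_cons, List.sum_cons] at hb
    obtain ⟨huv, hdv⟩ := hL v (by simp)
    have hune := huv.ne
    have hD := fun w => setDelay_same τ (u := u) (v := v) (w := w)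
    set τ₀ := setDelay u v τ with hτ₀
    set m := max (τ.s u - 1) (listMax (τ.l u)) with hm
    have hsv : τ₀.s v = m := by simp [hτ₀, setDelay, hm]
    have hfv := hfr v (by simp) v (inSubtree_self v)
    have hlv : τ₀.l v = [] := hfv.l
    have hready : Ready G r starts targets τ₀ v := by
      constructor
      · exact fun w hw hne => (hfr v (by simp) w hw).of_same (hD w hne)
      · exact hfv.processed
      · exact hfv.out
      · rw [hlv]; exact hfv.arr
      · rw [min_eq_left hdv.le]; exact hfv.d
      · rw [hlv, max_eq_right hdv.le]; simp
      · rw [hlv]; exact List.Pairwise.nil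
      · rw [hlv]; simp
      · rw [hlv, hsv]
        simp only [listMax, List.foldr_nil]
        omega
    obtain ⟨new₁, hP⟩ := hf v huv τ₀ hready
    have hE₁ : Evolve τ (f v τ₀) u 0 [] new₁ := (hD u hune).same_trans (hP.parent u huv)
    have hS₁ : ∀ w, w ≠ u → ¬ InSubtree G r v w → Same τ (f v τ₀) w := fun w hwu hw =>
      (hD w (by rintro rfl; exact hw (inSubtree_self _))).trans_same
        (hP.same w hw fun h => hwu (h.parent_unique hG huv))
    have hNZ := countIn_compl_targets (G := G) (r := r) starts targets v
    have hlen₁ := hP.len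
    have hbd₁ := hP.bound
    have hlt₁ := hP.s_lt
    rw [hsv] at hbd₁ hlt₁
    rw [max_eq_left (by omega)] at hlen₁
    set τ₁ := f v τ₀ with hτ₁
    have hsib : ∀ v' ∈ L, ∀ w, InSubtree G r v' w → ¬ InSubtree G r v w := by
      intro v' hv' w hw hw'
      have := huv.eq_of_inSubtree hG (hL v' (by simp [hv'])).1 hw' hw
      exact hnd.1 (this ▸ hv')
    have hs₁ : (τ₁.l u).Pairwise (· < ·) := by
      rw [hE₁.l, List.pairwise_append]
      refine ⟨hs, hP.sorted, fun a ha b hb => ?_⟩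
      have := le_listMax ha
      have := hlt₁ b hb
      omega
    have hmax₁ : max (τ₁.s u - 1) (listMax (τ₁.l u)) = max m (listMax new₁) := by
      rw [hE₁.s, hE₁.l, listMax_append, hm, max_assoc]
    -- The batch has exactly `-d₀(v)` members, which turns the bound of `Post` into this form.
    have hnew₁ : listMax new₁ ≤
        max (m + new₁.length) (countIn G r targetsᶜ v) := by
      apply listMax_le
      intro t ht
      have := hbd₁ t ht
      omega
    -- Hence either value in `hnew₁` is at most m + N(v): the share of `v` in the budget pays for
    -- its batch.
    have hlenN : new₁.length ≤ countIn G r targetsᶜ v := by omega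
    obtain ⟨τ', new, h1, h2, h3, h4, h5, h6, h7, h8, h9⟩ := ih τ₁ hnd.2
      (fun v' hv' => hL v' (by simp [hv']))
      (fun v' hv' w hw => (hfr v' (by simp [hv']) w hw).of_same
        (hS₁ w (hw.ne_of_child (hL v' (by simp [hv'])).1) (hsib v' hv' w hw)))
      hs₁ (by rw [hmax₁]; omega)
    refine ⟨τ', new₁ ++ new, by rw [List.foldl_cons, ← hτ₀, ← hτ₁, h1], ?_, ?_, h4, ?_, ?_, ?_,
      ?_, ?_⟩
    · simpa using hE₁.trans h2
    · rw [List.length_append, List.map_cons, List.sum_cons, ← h3]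
      push_cast
      omega
    · intro t ht
      rcases List.mem_append.1 ht with ht | ht
      · have := hlt₁ t ht
        omega
      · rw [← hE₁.s]
        exact h5 t ht
    · rw [← hE₁.s]
      exact h6
    -- The list grows by the batch size, and so may the maximum: the new values are m + |new₁| and
    -- N(v) = Z(v) + |new₁|, covered by `hC'` and `hC` respectively.
    · intro C hC hC'
      rw [← hE₁.s]
      have hlenl : (τ₁.l u).length = (τ.l u).length + new₁.length := by
        rw [hE₁.l, List.length_append]
      refine h7 C (fun v' hv' => ?_) ?_
      · have := hC v' (by simp [hv'])
        omega
      · rw [hmax₁, hlenl]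
        have := hC v (by simp)
        omega
    · intro v' hv' w hw
      rcases List.mem_cons.1 hv' with rfl | hv'
      · refine (hP.done w hw).of_same (h9 w (hw.ne_of_child huv) fun v'' hv'' h => ?_)
        exact hsib v'' hv'' w h hw
      · exact h8 v' hv' w hw
    · intro w hwu hw
      exact (hS₁ w hwu (hw v (by simp))).trans_same
        (h9 w hwu fun v' hv' => hw v' (by simp [hv']))

/-- The loop over the remaining children. -/
theorem foldl_rest_spec (hG : G.IsTree) (u : V) (f : V → State V → State V)
    (hf : ∀ v, IsChild G r u v → ∀ σ, Ready G r starts targets σ v →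
      ∃ new, Post G r starts targets σ v (f v σ) new) (L : List V) :
    ∀ τ : State V, L.Nodup →
    (∀ v ∈ L, IsChild G r u v ∧ 0 ≤ initialDemand G r starts targets v) →
    (∀ v ∈ L, Ready G r starts targets τ v) →
    (∀ v ∈ L, ∀ w, InSubtree G r v w →
      Done G r starts targets (L.foldl (fun ρ v => f v ρ) τ) w) ∧
    (∀ w, (∀ v ∈ L, ¬ InSubtree G r v w) → Same τ (L.foldl (fun ρ v => f v ρ) τ) w) := by
  induction L with
  | nil => exact fun τ _ _ _ => ⟨by simp, fun w _ => Evolve.refl _ _⟩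
  | cons v L ih =>
    intro τ hnd hL hR
    rw [List.nodup_cons] at hnd
    rw [List.foldl_cons]
    obtain ⟨huv, hdv⟩ := hL v (by simp)
    obtain ⟨new, hP⟩ := hf v huv τ (hR v (by simp))
    have hnew : new = [] := by
      have := hP.len
      rw [max_eq_right (by omega)] at this
      exact List.eq_nil_of_length_eq_zero (by exact_mod_cast this)
    have hS : ∀ w, ¬ InSubtree G r v w → Same τ (f v τ) w := by
      intro w hw
      by_cases h : IsChild G r w v
      · subst hnew
        exact hP.parent w h
      · exact hP.same w hw h
    have hsib : ∀ v' ∈ L, ∀ w, InSubtree G r v' w → ¬ InSubtree G r v w := by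
      intro v' hv' w hw hw'
      have := huv.eq_of_inSubtree hG (hL v' (by simp [hv'])).1 hw' hw
      exact hnd.1 (this ▸ hv')
    obtain ⟨h1, h2⟩ := ih (f v τ) hnd.2 (fun v' hv' => hL v' (by simp [hv']))
      (fun v' hv' => (hR v' (by simp [hv'])).of_same fun w hw => hS w (hsib v' hv' w hw))
    refine ⟨fun v' hv' w hw => ?_, fun w hw => ?_⟩
    · rcases List.mem_cons.1 hv' with rfl | hv'
      · exact (hP.done w hw).of_same (h2 w fun v'' hv'' h => hsib v'' hv'' w h hw)
      · exact h1 v' hv' w hw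
    · exact (hS w (hw v (by simp))).trans_same (h2 w fun v' hv' => hw v' (by simp [hv']))

end Spec

/-! ### The induction over the rooted tree -/

section Recursion

variable {V : Type*} [Fintype V] [DecidableEq V] {G : SimpleGraph V} {r : V}
  {starts targets : Finset V}

omit [Fintype V] in
theorem insertStart_d (σ : State V) (u : V) : (insertStart starts u σ).d = σ.d := by
  unfold insertStart; split_ifs <;> rfl

omit [Fintype V] in
theorem insertStart_s (σ : State V) (u : V) : (insertStart starts u σ).s = σ.s := by
  unfold insertStart; split_ifs <;> rfl

omit [Fintype V] in
theorem insertStart_output (σ : State V) (u : V) :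
    (insertStart starts u σ).output = σ.output := by
  unfold insertStart; split_ifs <;> rfl

omit [Fintype V] in
theorem insertStart_l (σ : State V) (u : V) :
    (insertStart starts u σ).l u = (if u ∈ starts then [σ.s u] else []) ++ σ.l u := by
  unfold insertStart; split_ifs <;> simp

/-- One level of the recursion: if the calls for the children meet their specification, so does
the call for `u`. -/
theorem post_of_children (hG : G.IsTree) (hcard : #starts = #targets) (χ : Choices G r) (u : V)
    (f : V → State V → State V)
    (hf : ∀ v, IsChild G r u v → ∀ σ, Ready G r starts targets σ v →
      ∃ new, Post G r starts targets σ v (f v σ) new)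
    (σ : State V) (hσ : Ready G r starts targets σ u) (σ₁ σ₃ : State V)
    (hσ₁ : σ₁ = insertStart starts u σ)
    (hσ₃ : σ₃ = markProcessed u (sendAll G r χ u
      ((χ.negOrder σ₁ u).foldl (fun ρ v => f v (setDelay u v ρ)) σ₁))) :
    ∃ new, Post G r starts targets σ u ((χ.restOrder σ₃ u).foldl (fun ρ v => f v ρ) σ₃) new := by
  classical
  have hfresh : ∀ c, IsChild G r u c → ∀ w, InSubtree G r c w → Fresh G r starts targets σ w :=
    fun c hc w hw => hσ.fresh w (hw.of_child hG hc) (hw.ne_of_child hc)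
  have hS₁ : ∀ w, w ≠ u → Same σ σ₁ w := fun w hw => hσ₁ ▸ insertStart_same starts σ hw
  have hd₁ : σ₁.d = σ.d := by rw [hσ₁, insertStart_d]
  have hs₁ : σ₁.s = σ.s := by rw [hσ₁, insertStart_s]
  have ho₁ : σ₁.output = σ.output := by rw [hσ₁, insertStart_output]
  have hl₁ : σ₁.l u = (if u ∈ starts then [σ.s u] else []) ++ σ.l u := by
    rw [hσ₁, insertStart_l]
  set pre : List ℕ := if u ∈ starts then [σ.s u] else [] with hpre
  have hprelen : pre.length = if u ∈ starts then 1 else 0 := by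
    rw [hpre]; split_ifs <;> rfl
  have hpremem : ∀ t ∈ pre, t = σ.s u := by
    intro t ht
    rw [hpre] at ht
    split_ifs at ht <;> simp_all
  set d₀ := initialDemand G r starts targets with hd₀
  set N := countIn G r targetsᶜ with hN
  set Z := countIn G r startsᶜ with hZ
  -- the children with negative demand
  have hmemL : ∀ v, v ∈ χ.negOrder σ₁ u ↔ IsChild G r u v ∧ d₀ v < 0 := by
    intro v
    rw [χ.mem_negOrder, hd₁]
    refine and_congr_right fun h => ?_
    rw [(hfresh v h v (inSubtree_self v)).d]
  have hndL := χ.negOrder_nodup σ₁ u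
  set L := χ.negOrder σ₁ u with hL
  have hLset : L.toFinset = {c ∈ children G r u | d₀ c < 0} := by
    ext v; simp [hmemL]
  -- The part of N(u) not spent on negative children: `u` itself, and the subtrees entered only
  -- after the agents at `u` have been sent.
  set K := (if u ∈ targetsᶜ then 1 else 0) + ∑ c ∈ children G r u with ¬ d₀ c < 0, N c with hK
  have hLN : (L.map N).sum = ∑ c ∈ children G r u with d₀ c < 0, N c := by
    rw [← hLset, List.sum_toFinset _ hndL]
  have hLd : (L.map fun v => -d₀ v).sum = -∑ c ∈ children G r u with d₀ c < 0, d₀ c := by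
    rw [← hLset, ← Finset.sum_neg_distrib, List.sum_toFinset _ hndL]
  have hNu : N u = K + (L.map N).sum := by
    rw [hLN, hK, hN, countIn_eq hG, ← Finset.sum_filter_add_sum_filter_not _ (fun c => d₀ c < 0)]
    ring
  have hZu : Z u = (if u ∈ startsᶜ then 1 else 0) + ∑ c ∈ children G r u, Z c :=
    countIn_eq hG _ u
  have hdu : d₀ u = (if u ∈ targets then 1 else 0) - (if u ∈ starts then 1 else 0) +
      ((∑ c ∈ children G r u with d₀ c < 0, d₀ c) +
        ∑ c ∈ children G r u with ¬ d₀ c < 0, d₀ c) := by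
    rw [Finset.sum_filter_add_sum_filter_not, hd₀]
    simp only [initialDemand_eq]
    rw [countIn_eq hG targets u, countIn_eq hG starts u, Finset.sum_sub_distrib]
    push_cast
    ring
  have hsort₁ : (σ₁.l u).Pairwise (· < ·) := by
    rw [hl₁, List.pairwise_append]
    refine ⟨?_, hσ.sorted, fun a ha b hb => ?_⟩
    · rw [hpre]; split_ifs <;> simp
    · rw [hpremem a ha]
      exact hσ.s_lt b hb
  have hge₁ : ∀ t ∈ σ₁.l u, σ.s u ≤ t := by
    intro t ht
    rw [hl₁] at ht
    rcases List.mem_append.1 ht with h | h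
    · exact (hpremem t h).ge
    · exact (hσ.s_lt t h).le
  have hmax₁ : listMax (σ₁.l u) ≤ max (σ.s u) (listMax (σ.l u)) := by
    rw [hl₁, listMax_append]
    exact max_le_max (listMax_le fun t ht => (hpremem t ht).le) le_rfl
  have hσb : max (σ.s u) (listMax (σ.l u)) + N u ≤ #targetsᶜ := hσ.bound
  obtain ⟨τ, new₁, hτ, hE₁, hnew₁, hsortτ, hnewge, hbτ, hCτ, hdoneτ, hsameτ⟩ :=
    foldl_neg_spec hG u f hf K L σ₁ hndL (fun v hv => (hmemL v).1 hv)
      (fun v hv w hw => by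
        have hv' := ((hmemL v).1 hv).1
        exact (hfresh v hv' w hw).of_same (hS₁ w (hw.ne_of_child hv'))) hsort₁
      (by
        rw [hs₁]
        change _ + K + (L.map N).sum ≤ _
        omega)
  rw [hs₁] at hnewge hbτ hCτ
  rw [hτ] at hσ₃
  have hlτ : τ.l u = pre ++ (σ.l u ++ new₁) := by
    rw [hE₁.l, hl₁, List.append_assoc]
  have hgeτ : ∀ t ∈ τ.l u, σ.s u ≤ t := by
    intro t ht
    rw [hE₁.l] at ht
    rcases List.mem_append.1 ht with h | h
    · exact hge₁ t h
    · exact hnewge t h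
  have hdτu : τ.d u = min (d₀ u) 0 := by rw [hE₁.d, hd₁, hσ.d, add_zero]
  have hnotL : ∀ c, IsChild G r u c → ¬ d₀ c < 0 → ∀ w, InSubtree G r c w →
      ∀ v ∈ L, ¬ InSubtree G r v w := by
    intro c hc hdc w hw v hv h
    obtain ⟨h1, h2⟩ := (hmemL v).1 hv
    obtain rfl := hc.eq_of_inSubtree hG h1 hw h
    exact hdc h2
  have hSτ : ∀ w, w ≠ u → (∀ v ∈ L, ¬ InSubtree G r v w) → Same σ τ w := fun w hw h =>
    (hS₁ w hw).same_trans (hsameτ w hw h)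
  have hdτneg : ∀ c, IsChild G r u c → d₀ c < 0 → τ.d c = 0 := fun c hc h =>
    (hdoneτ c ((hmemL c).2 ⟨hc, h⟩) c (inSubtree_self c)).d
  have hdτpos : ∀ c, IsChild G r u c → ¬ d₀ c < 0 → τ.d c = d₀ c := fun c hc h => by
    rw [(hSτ c hc.ne.symm (hnotL c hc h c (inSubtree_self c))).d, add_zero]
    exact (hfresh c hc c (inSubtree_self c)).d
  have hsumτ : ∑ c ∈ children G r u, τ.d c = ∑ c ∈ children G r u with ¬ d₀ c < 0, d₀ c := by
    rw [← Finset.sum_filter_add_sum_filter_not _ (fun c => d₀ c < 0), Finset.sum_eq_zero,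
      zero_add]
    · refine Finset.sum_congr rfl fun c hc => ?_
      rw [mem_filter, mem_children] at hc
      exact hdτpos c hc.1 hc.2
    · intro c hc
      rw [mem_filter, mem_children] at hc
      exact hdτneg c hc.1 hc.2
  have hlenσ := hσ.len
  have hlenτ : ((τ.l u).length : ℤ) = (if u ∈ starts then 1 else 0) + max (d₀ u) 0 -
      ∑ c ∈ children G r u with d₀ c < 0, d₀ c := by
    rw [hlτ, List.length_append, List.length_append, hprelen]
    push_cast
    rw [hlenσ, hnew₁, hLd]
    ring
  -- sending the agents
  obtain ⟨mv, rest, dn, e1, e2, e3, e4, e5, e6, e7⟩ :=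
    foldl_sendAgent_spec hG χ u (τ.l u) τ (if u ∈ targets then 1 else 0)
      (by rw [hdτu]; exact min_le_right _ _)
      (fun c hc => by
        by_cases h : d₀ c < 0
        · rw [hdτneg c hc h]
        · rw [hdτpos c hc h]; omega)
      -- Equally many starts and targets give the root demand 0, so nobody is sent up from the root.
      (fun h => exists_isChild_of_ne hG (by
        rintro rfl
        rw [hdτu, hd₀, initialDemand_eq, countIn_root, countIn_root, hcard] at h
        simp at h))
      (by
        rw [hsumτ, hlenτ, hdτu]
        push_cast
        omega)
  change σ₃ = markProcessed u ((τ.l u).foldl (sendAgent G r χ u) τ) at hσ₃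
  set ρ := (τ.l u).foldl (sendAgent G r χ u) τ with hρ
  have hS₃ : ∀ w, w ≠ u → Same ρ σ₃ w := fun w hw => hσ₃ ▸ markProcessed_same ρ hw
  have hmvmem : ∀ m ∈ mv, m.time ∈ τ.l u := fun m hm => by
    rw [← e1]
    exact List.mem_append_left _ (List.mem_map_of_mem hm)
  have hdone₃ : Done G r starts targets σ₃ u := by
    have hl₃ : σ₃.l u = τ.l u := by
      rw [hσ₃]; exact e4.l.trans (List.append_nil _)
    have ho₃ : outMoves σ₃ u = mv := by
      rw [hσ₃]
      refine e4.out.trans ?_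
      rw [hE₁.out, List.append_nil, outMoves, ho₁]
      rw [← outMoves, hσ.out, List.nil_append]
    have ha₃ : arrivals σ₃ u = σ.l u ++ new₁ := by
      rw [hσ₃]
      refine e4.arr.trans ?_
      rw [hE₁.arr, List.append_nil, arrivals, ho₁]
      rw [← arrivals, hσ.arr]
    have hs₃ : σ₃.s u = σ.s u := by
      rw [hσ₃]
      refine e4.s.trans ?_
      rw [hE₁.s, hs₁]
    constructor
    · rw [hσ₃]
      exact e4.d.trans (add_neg_cancel _)
    · rw [hσ₃]
      exact Finset.mem_insert_self _ _
    · rw [hl₃]; exact hsortτ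
    · intro t ht
      rw [hl₃] at ht
      have := le_listMax ht
      omega
    · rw [hl₃, ha₃, hs₃, hlτ]
    · exact ⟨rest, by rw [hl₃, ho₃, e1], e2⟩
    · intro m hm
      rw [ho₃] at hm
      obtain ⟨hsrc, ⟨h1, h2⟩ | ⟨h1, h2⟩⟩ := e3 m hm
      · refine Or.inl ⟨hsrc ▸ h1, ?_⟩
        rw [hsrc]
        change d₀ u < 0
        omega
      · refine Or.inr ⟨hsrc ▸ h1, ?_⟩
        change 0 < d₀ m.dst
        by_cases h : d₀ m.dst < 0
        · rw [hdτneg _ h1 h] at h2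
          omega
        · rwa [hdτpos _ h1 h] at h2
  have hSsub : ∀ c, IsChild G r u c → ∀ w, InSubtree G r c w → w ≠ c → Same τ σ₃ w := by
    intro c hc w hw hne
    refine (e7 w (hw.ne_of_child hc) (fun h => hne ?_) fun h => ?_).trans_same
      (hS₃ w (hw.ne_of_child hc))
    · exact h.eq_of_inSubtree hG hc (inSubtree_self w) hw
    · have := hw.dist_le
      have := hc.2
      have := h.2
      omega
  have hdn : ∀ c, IsChild G r u c → ∀ t ∈ dn c, ∃ m ∈ mv, m.time + 1 = t := by
    intro c hc t ht
    exact List.mem_map.1 ((e5 c hc).1.subset ht)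
  have hready₃ : ∀ c, IsChild G r u c → ¬ d₀ c < 0 → Ready G r starts targets σ₃ c := by
    intro c hc hdc
    have hfr := hfresh c hc c (inSubtree_self c)
    obtain ⟨g1, g2, g3⟩ := e5 c hc
    have hE : Evolve σ σ₃ c (-τ.d c) [] (dn c) :=
      (hSτ c hc.ne.symm (hnotL c hc hdc c (inSubtree_self c))).same_trans
        (g3.trans_same (hS₃ c hc.ne.symm))
    have hl : σ₃.l c = dn c := by rw [hE.l, hfr.l, List.nil_append]
    constructor
    · intro w hw hne
      exact ((hfresh c hc w hw).of_same (hSτ w (hw.ne_of_child hc) (hnotL c hc hdc w hw))).of_same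
        (hSsub c hc w hw hne)
    · rw [hE.processed]
      exact hfr.processed
    · rw [hE.out, hfr.out, List.nil_append]
    · rw [hE.arr, hfr.arr, List.nil_append, hl]
    · rw [hE.d, hfr.d, hdτpos c hc hdc, min_eq_right (not_lt.1 hdc)]
      exact add_neg_cancel _
    · rw [hl, g2, hdτpos c hc hdc]
      exact (max_eq_left (not_lt.1 hdc)).symm
    · rw [hl]
      refine List.Pairwise.sublist g1 ?_
      have h1 : (mv.map Move.time).Pairwise (· < ·) := by
        rw [← e1] at hsortτ
        exact (List.pairwise_append.1 hsortτ).1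
      rw [List.pairwise_map] at h1 ⊢
      exact h1.imp fun h => Nat.add_lt_add_right h 1
    -- Only children of negative demand receive a delay; here `s` still has its initial value 0,
    -- below every arrival time.
    · rw [hl, hE.s, hfr.s]
      intro t ht
      obtain ⟨m, -, rfl⟩ := hdn c hc t ht
      exact Nat.succ_pos _
    · rw [hl, hE.s, hfr.s, Nat.zero_max]
      have hNc : N c ≤ ∑ c ∈ children G r u with ¬ d₀ c < 0, N c :=
        Finset.single_le_sum (f := N) (fun _ _ => Nat.zero_le _)
          (mem_filter.2 ⟨mem_children.2 hc, hdc⟩)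
      -- The step down takes one time unit. A non-target `u` pays for it from the budget; at a
      -- target the last entry stays, so every departure is strictly earlier than the maximum.
      have hmaxdn : listMax (dn c) ≤ listMax (τ.l u) + if u ∈ targetsᶜ then 1 else 0 := by
        apply listMax_le
        intro t ht
        obtain ⟨m, hm, rfl⟩ := hdn c hc t ht
        by_cases hu : u ∈ targets
        · rw [if_pos hu] at e2
          obtain ⟨x, rfl⟩ := List.length_eq_one_iff.1 e2
          have h1 := hsortτ
          rw [← e1] at h1
          have h2 := (List.pairwise_append.1 h1).2.2 m.time (List.mem_map_of_mem hm) x (by simp)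
          have h3 : x ≤ listMax (τ.l u) := le_listMax (by rw [← e1]; simp)
          omega
        · rw [if_pos (mem_compl.2 hu)]
          have := le_listMax (hmvmem m hm)
          omega
      change listMax (dn c) + N c ≤ _
      omega
  -- the remaining children
  have hmemR : ∀ v, v ∈ χ.restOrder σ₃ u ↔ IsChild G r u v ∧ ¬ d₀ v < 0 := by
    intro v
    rw [χ.mem_restOrder]
    refine and_congr_right fun hv => ?_
    constructor
    · intro h hneg
      apply h
      rw [((e5 v hv).2.2.trans_same (hS₃ v hv.ne.symm)).processed]
      exact (hdoneτ v ((hmemL v).2 ⟨hv, hneg⟩) v (inSubtree_self v)).processed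
    · exact fun h => (hready₃ v hv h).processed
  obtain ⟨hdoneR, hsameR⟩ := foldl_rest_spec hG u f hf (χ.restOrder σ₃ u) σ₃
    (χ.restOrder_nodup σ₃ u)
    (fun v hv => ⟨((hmemR v).1 hv).1, not_lt.1 ((hmemR v).1 hv).2⟩)
    (fun v hv => hready₃ v ((hmemR v).1 hv).1 ((hmemR v).1 hv).2)
  set φ := (χ.restOrder σ₃ u).foldl (fun ρ v => f v ρ) σ₃ with hφ
  have hn : ((-τ.d u).toNat : ℤ) = max (-d₀ u) 0 := by
    rw [hdτu]
    omega
  have hupmem : ∀ t ∈ (τ.l u).take (-τ.d u).toNat, t ∈ τ.l u := fun t ht =>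
    List.mem_of_mem_take ht
  have houtτ : ∀ w, ¬ InSubtree G r u w → Same σ τ w := fun w hw =>
    hSτ w (by rintro rfl; exact hw (inSubtree_self _))
      fun v hv h => hw (h.of_child hG ((hmemL v).1 hv).1)
  have houtφ : ∀ w, ¬ InSubtree G r u w → Same ρ φ w := fun w hw =>
    (hS₃ w (by rintro rfl; exact hw (inSubtree_self _))).same_trans
      (hsameR w fun v hv h => hw (h.of_child hG ((hmemR v).1 hv).1))
  refine ⟨((τ.l u).take (-τ.d u).toNat).map (· + 1), ?_, ?_, ?_, ?_, ?_, ?_, ?_⟩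
  · intro w hw
    by_cases hwu : w = u
    · subst hwu
      exact hdone₃.of_same (hsameR w fun v hv h => ((hmemR v).1 hv).1.not_inSubtree h)
    · obtain ⟨c, hc, hcw⟩ := hw.exists_child hG hwu
      by_cases hdc : d₀ c < 0
      · have hD := hdoneτ c ((hmemL c).2 ⟨hc, hdc⟩) w hcw
        have hD₃ : Done G r starts targets σ₃ w := by
          by_cases hwc : w = c
          · subst hwc
            obtain ⟨-, g2, g3⟩ := e5 w hc
            rw [hD.d] at g2 g3
            have hnil : dn w = [] := List.eq_nil_of_length_eq_zero (by exact_mod_cast g2)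
            rw [hnil, neg_zero] at g3
            exact hD.of_same (g3.trans_same (hS₃ w hwu))
          · exact hD.of_same (hSsub c hc w hcw hwc)
        refine hD₃.of_same (hsameR w fun v hv h => ?_)
        obtain ⟨h1, h2⟩ := (hmemR v).1 hv
        obtain rfl := hc.eq_of_inSubtree hG h1 hcw h
        exact h2 hdc
      · exact hdoneR c ((hmemR c).2 ⟨hc, hdc⟩) w hcw
  · rw [List.pairwise_map]
    exact (hsortτ.sublist (List.take_sublist _ _)).imp fun h => Nat.add_lt_add_right h 1
  · rw [List.length_map, List.length_take]
    push_cast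
    rw [hn, hlenτ, min_eq_left]
    have : 0 ≤ ∑ c ∈ children G r u with ¬ d₀ c < 0, d₀ c :=
      Finset.sum_nonneg fun c hc => not_lt.1 (mem_filter.1 hc).2
    split_ifs at hdu ⊢ <;> omega
  · intro t ht
    obtain ⟨a, ha, rfl⟩ := List.mem_map.1 ht
    exact Nat.lt_succ_of_le (hgeτ a (hupmem a ha))
  · intro t ht
    obtain ⟨a, ha, rfl⟩ := List.mem_map.1 ht
    have hneg : d₀ u < 0 := by
      by_contra h
      have h0 : (-τ.d u).toNat = 0 := by omega
      simp [h0] at ha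
    have hlσ : σ.l u = [] := by
      rw [max_eq_right hneg.le] at hlenσ
      exact List.eq_nil_of_length_eq_zero (by exact_mod_cast hlenσ)
    -- The extra 1 in both conditions is paid by `u` itself: a start adds an entry to `l(u)`, a
    -- non-start adds one to Z(u).
    have hC := hCτ (max (σ.s u) (Z u)) (fun v hv => by
        have : Z v ≤ ∑ c ∈ children G r u, Z c :=
          Finset.single_le_sum (f := Z) (fun _ _ => Nat.zero_le _)
            (mem_children.2 ((hmemL v).1 hv).1)
        rw [hl₁, List.length_append, hprelen]
        change Z v + 1 ≤ _
        by_cases hu : u ∈ starts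
        · rw [if_pos hu]; omega
        · rw [if_pos (mem_compl.2 hu)] at hZu; omega) (by
        rw [hlσ] at hmax₁
        have h0 : listMax ([] : List ℕ) = 0 := rfl
        rw [h0] at hmax₁
        have hlen₁ : (σ₁.l u).length = if u ∈ starts then 1 else 0 := by
          rw [hl₁, List.length_append, hprelen, hlσ, List.length_nil, add_zero]
        by_cases hu : u ∈ starts
        · rw [if_pos hu] at hlen₁; omega
        · have hnil : σ₁.l u = [] := List.eq_nil_of_length_eq_zero (by rw [hlen₁, if_neg hu])
          rw [if_pos (mem_compl.2 hu)] at hZu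
          rw [hnil, h0, List.length_nil]
          omega)
    have hb := prefix_bound (C := max (σ.s u) (Z u)) (a := (τ.l u).take (-τ.d u).toNat)
      (b := (τ.l u).drop (-τ.d u).toNat) (by rw [List.take_append_drop]; exact hsortτ) (by
        rw [List.take_append_drop]
        intro t ht
        have := le_listMax ht
        omega) a ha
    -- The prefix has at most `-d₀ u` entries, so the arrival is at most max(s(u), Z(u)) - d₀(u),
    -- and Z(u) - d₀(u) = N(u).
    rw [List.length_take] at hb
    have hNZ : (N u : ℤ) = Z u - d₀ u := countIn_compl_targets starts targets u
    change ((a + 1 : ℕ) : ℤ) ≤ max (σ.s u - d₀ u) (N u)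
    omega
  · intro p hp
    have hpu : ¬ InSubtree G r u p := hp.not_inSubtree
    exact (houtτ p hpu).same_trans ((e6 p hp).trans_same (houtφ p hpu))
  · intro w hw hwp
    refine (houtτ w hw).same_trans (Evolve.same_trans (e7 w ?_ ?_ hwp) (houtφ w hw))
    · rintro rfl
      exact hw (inSubtree_self _)
    · exact fun h => hw h.inSubtree

theorem directTraffic_spec (hG : G.IsTree) (hcard : #starts = #targets) (χ : Choices G r)
    (u : V) (σ : State V) (hσ : Ready G r starts targets σ u) :
    ∃ new, Post G r starts targets σ u (directTraffic G r starts χ u σ) new := by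
  induction hn : #{w : V | G.dist r u < G.dist r w} using Nat.strong_induction_on
    generalizing u σ with
  | _ n ih =>
    rw [directTraffic]
    -- The attached membership proofs serve only termination; without them the loops are plain
    -- folds.
    simp only [List.foldl_subtype, List.unattach_attach]
    refine post_of_children hG hcard χ u (directTraffic G r starts χ) (fun v hv τ hτ => ?_) σ hσ
      _ _ rfl rfl
    exact ih _ (hn ▸ card_deeper_lt G r hv) v τ hτ rfl

/-- At the end, the calls for all nodes are complete. -/
theorem done_directTraffic (hG : G.IsTree) (hcard : #starts = #targets) (χ : Choices G r)
    (w : V) :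
    Done G r starts targets
      (directTraffic G r starts χ r (initialState G r starts targets)) w := by
  have hroot : initialDemand G r starts targets r = 0 := by
    rw [initialDemand_eq, countIn_root, countIn_root, hcard, sub_self]
  have hready : Ready G r starts targets (initialState G r starts targets) r := by
    constructor
    · intro w _ _
      constructor <;> simp [initialState, outMoves, arrivals]
    · simp [initialState]
    · simp [initialState, outMoves]
    · simp [initialState, arrivals]
    · simp [initialState, hroot]
    · simp [initialState, hroot]
    · simp [initialState]
    · simp [initialState]
    · rw [countIn_root]
      simp [initialState, listMax]
  obtain ⟨new, h⟩ := directTraffic_spec hG hcard χ r _ hready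
  exact h.done w (inSubtree_root w)

end Recursion

/-! ### Feasibility of the final plan -/

section Positions

variable {V : Type*} [DecidableEq V]

theorem stepPos_of_mem {plan : List (Move V)}
    (hu : ∀ m ∈ plan, ∀ n ∈ plan, m.src = n.src → m.time = n.time → m = n) {m : Move V}
    (hm : m ∈ plan) : stepPos plan m.src m.time = m.dst := by
  unfold stepPos
  cases h : plan.find? fun n => decide (n.src = m.src ∧ n.time = m.time) with
  | none =>
    rw [List.find?_eq_none] at h
    simpa using h m hm
  | some n =>
    have h1 := List.find?_some h
    have h2 := List.mem_of_find?_eq_some h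
    simp only [decide_eq_true_eq] at h1
    rw [hu n h2 m hm h1.1 h1.2]

theorem stepPos_eq_or (plan : List (Move V)) (x : V) (t : ℕ) :
    (∃ m ∈ plan, m.src = x ∧ m.time = t ∧ stepPos plan x t = m.dst) ∨
      (∀ m ∈ plan, m.src = x → m.time ≠ t) ∧ stepPos plan x t = x := by
  unfold stepPos
  cases h : plan.find? fun n => decide (n.src = x ∧ n.time = t) with
  | none =>
    right
    rw [List.find?_eq_none] at h
    refine ⟨fun m hm h1 h2 => ?_, rfl⟩
    simpa [h1, h2] using h m hm
  | some n =>
    left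
    have h1 := List.find?_some h
    simp only [decide_eq_true_eq] at h1
    exact ⟨n, List.mem_of_find?_eq_some h, h1.1, h1.2, rfl⟩

omit [DecidableEq V] in
theorem time_lt_horizon {plan : List (Move V)} {m : Move V} (hm : m ∈ plan) :
    m.time < horizon plan :=
  le_listMax (l := plan.map fun m => m.time + 1) (List.mem_map.2 ⟨m, hm, rfl⟩)

theorem pathLength_le (plan : List (Move V)) (a : V) : pathLength plan a ≤ horizon plan :=
  (Finset.card_filter_le _ _).trans (Finset.card_range _).le

end Positions

/-! ### Reading the agents' motion off the completed lists -/

section Final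

variable {V : Type*} [Fintype V] [DecidableEq V] {G : SimpleGraph V} {r : V}
  {starts targets : Finset V} {F : State V}

omit [Fintype V] in
theorem mem_outMoves {m : Move V} {w : V} : m ∈ outMoves F w ↔ m ∈ F.output ∧ m.src = w := by
  simp [outMoves]

omit [Fintype V] in
theorem mem_arrivals {t : ℕ} {w : V} :
    t ∈ arrivals F w ↔ ∃ m ∈ F.output, m.dst = w ∧ m.time + 1 = t := by
  simp [arrivals, and_assoc]

theorem Done.move_unique (h : ∀ w, Done G r starts targets F w) {m n : Move V}
    (hm : m ∈ F.output) (hn : n ∈ F.output) (hs : m.src = n.src) (ht : m.time = n.time) :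
    m = n := by
  obtain ⟨rest, hr, -⟩ := (h n.src).out
  have hsort := (h n.src).sorted
  rw [← hr] at hsort
  exact List.inj_on_of_nodup_map ((List.pairwise_append.1 hsort).1.imp fun h => ne_of_lt h)
    (mem_outMoves.2 ⟨hm, hs⟩) (mem_outMoves.2 ⟨hn, rfl⟩) ht

theorem Done.arrival_unique (h : ∀ w, Done G r starts targets F w) {m n : Move V}
    (hm : m ∈ F.output) (hn : n ∈ F.output) (hs : m.dst = n.dst) (ht : m.time = n.time) :
    m = n := by
  have hsort := (h n.dst).sorted
  rw [(h n.dst).arr] at hsort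
  refine List.inj_on_of_nodup_map
    ((List.pairwise_append.1 hsort).2.1.imp fun h => ne_of_lt h) ?_ ?_
    (congrArg (· + 1) ht)
  · simp [hm, hs]
  · simp [hn]

theorem Done.time_mem (h : ∀ w, Done G r starts targets F w) {m : Move V}
    (hm : m ∈ F.output) : m.time ∈ F.l m.src := by
  obtain ⟨rest, hr, -⟩ := (h m.src).out
  rw [← hr]
  exact List.mem_append_left _ (List.mem_map_of_mem (mem_outMoves.2 ⟨hm, rfl⟩))

theorem Done.time_succ_mem (h : ∀ w, Done G r starts targets F w) {m : Move V}
    (hm : m ∈ F.output) : m.time + 1 ∈ F.l m.dst := by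
  rw [(h m.dst).arr]
  exact List.mem_append_right _ (mem_arrivals.2 ⟨m, hm, rfl, rfl⟩)

theorem Done.s_mem {w : V} (h : Done G r starts targets F w) (hw : w ∈ starts) :
    F.s w ∈ F.l w := by
  rw [h.arr, if_pos hw]; simp

theorem Done.s_lt_arrival {w : V} (h : Done G r starts targets F w) (hw : w ∈ starts) {t : ℕ}
    (ht : t ∈ arrivals F w) : F.s w < t := by
  have hs := h.sorted
  rw [h.arr, if_pos hw] at hs
  exact (List.pairwise_append.1 hs).2.2 _ (by simp) t ht

theorem Done.s_le {w : V} (h : Done G r starts targets F w) (hw : w ∈ starts) {t : ℕ}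
    (ht : t ∈ F.l w) : F.s w ≤ t := by
  rw [h.arr, if_pos hw] at ht
  rcases List.mem_append.1 ht with ht | ht
  · exact (List.mem_singleton.1 ht).ge
  · exact (h.s_lt_arrival hw ht).le

/-- A time of `l(w)` at which no agent leaves `w` is the last one, and `w` is a target. -/
theorem Done.stay {w : V} (h : Done G r starts targets F w) {t₀ : ℕ} (ht : t₀ ∈ F.l w)
    (hout : ∀ m ∈ F.output, m.src = w → m.time ≠ t₀) :
    w ∈ targets ∧ (∀ t ∈ F.l w, t ≤ t₀) := by
  obtain ⟨rest, hr, hlen⟩ := h.out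
  have hs := h.sorted
  rw [← hr] at ht hs ⊢
  have hrest : t₀ ∈ rest := by
    rcases List.mem_append.1 ht with h1 | h1
    · obtain ⟨m, hm, hmt⟩ := List.mem_map.1 h1
      exact absurd hmt (hout m (mem_outMoves.1 hm).1 (mem_outMoves.1 hm).2)
    · exact h1
  have hw : w ∈ targets := by
    by_contra hw
    rw [if_neg hw] at hlen
    rw [List.eq_nil_of_length_eq_zero hlen] at hrest
    simp at hrest
  rw [if_pos hw] at hlen
  obtain ⟨x, rfl⟩ := List.length_eq_one_iff.1 hlen
  obtain rfl := List.mem_singleton.1 hrest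
  refine ⟨hw, fun t ht => ?_⟩
  rcases List.mem_append.1 ht with h1 | h1
  · exact ((List.pairwise_append.1 hs).2.2 t h1 t₀ (by simp)).le
  · exact (List.mem_singleton.1 h1).le

/-- The ways in which an agent can be at `x` at time `t`: it has not yet left its start, it is
at `x` at a time of `l(x)`, or it stays at `x` forever. -/
def Occupied (starts : Finset V) (F : State V) (x : V) (t : ℕ) : Prop :=
  (x ∈ starts ∧ t < F.s x) ∨ t ∈ F.l x ∨
    ∃ t₀ ∈ F.l x, t₀ < t ∧ ∀ m ∈ F.output, m.src = x → m.time ≠ t₀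

theorem Occupied.step (h : ∀ w, Done G r starts targets F w) {x : V} {t : ℕ}
    (ho : Occupied starts F x t) : Occupied starts F (stepPos F.output x t) (t + 1) := by
  rcases stepPos_eq_or F.output x t with ⟨m, hm, rfl, rfl, hs⟩ | ⟨hno, hs⟩
  · rw [hs]
    exact Or.inr (Or.inl (Done.time_succ_mem h hm))
  · rw [hs]
    rcases ho with ⟨hx, ht⟩ | ht | ⟨t₀, ht₀, hlt, hno₀⟩
    · rcases (Nat.succ_le_of_lt ht).lt_or_eq with h1 | h1
      · exact Or.inl ⟨hx, h1⟩
      · have hmem := (h x).s_mem hx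
        rw [← h1] at hmem
        exact Or.inr (Or.inl hmem)
    · exact Or.inr (Or.inr ⟨t, ht, Nat.lt_succ_self t, hno⟩)
    · exact Or.inr (Or.inr ⟨t₀, ht₀, Nat.lt_succ_of_lt hlt, hno₀⟩)

/-- No agent arrives at a node at which another agent waits. -/
theorem Occupied.not_arrival (h : ∀ w, Done G r starts targets F w) {m : Move V}
    (hm : m ∈ F.output) (ho : Occupied starts F m.dst m.time)
    (hno : ∀ n ∈ F.output, n.src = m.dst → n.time ≠ m.time) : False := by
  have harr := Done.time_succ_mem h hm
  rcases ho with ⟨hx, ht⟩ | ht | ⟨t₀, ht₀, hlt, hno₀⟩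
  · have := (h m.dst).s_lt_arrival hx (mem_arrivals.2 ⟨m, hm, rfl, rfl⟩)
    omega
  · have := ((h m.dst).stay ht hno).2 _ harr
    omega
  · have := ((h m.dst).stay ht₀ hno₀).2 _ harr
    omega

/-- Two moves into one node at one time are the same move, and a move never enters a node where an
agent waits. Injectivity of each step excludes vertex conflicts at all times. -/
theorem Occupied.step_injective (h : ∀ w, Done G r starts targets F w) {x y : V} {t : ℕ}
    (hx : Occupied starts F x t) (hy : Occupied starts F y t)
    (he : stepPos F.output x t = stepPos F.output y t) : x = y := by
  rcases stepPos_eq_or F.output x t with ⟨m, hm, rfl, rfl, hs⟩ | ⟨hno, hs⟩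
  · rcases stepPos_eq_or F.output y m.time with ⟨n, hn, rfl, hnt, hs'⟩ | ⟨hno', hs'⟩
    · rw [Done.arrival_unique h hm hn (by rw [← hs, he, hs']) hnt.symm]
    · have hd : m.dst = y := by rw [← hs, he, hs']
      subst hd
      exact (hy.not_arrival h hm hno').elim
  · rcases stepPos_eq_or F.output y t with ⟨n, hn, rfl, rfl, hs'⟩ | ⟨hno', hs'⟩
    · have hd : n.dst = x := by rw [← hs, he, hs']
      subst hd
      exact (hx.not_arrival h hn hno).elim
    · rw [← hs, he, hs']

theorem occupied_position (h : ∀ w, Done G r starts targets F w) {a : V} (ha : a ∈ starts)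
    (t : ℕ) : Occupied starts F (position F.output a t) t := by
  induction t with
  | zero =>
    rcases Nat.eq_zero_or_pos (F.s a) with h0 | h0
    · have hmem := (h a).s_mem ha
      rw [h0] at hmem
      exact Or.inr (Or.inl hmem)
    · exact Or.inl ⟨ha, h0⟩
  | succ t ih => exact ih.step h

theorem position_injective (h : ∀ w, Done G r starts targets F w) {a b : V} (ha : a ∈ starts)
    (hb : b ∈ starts) (t : ℕ) (he : position F.output a t = position F.output b t) : a = b := by
  induction t with
  | zero => exact he
  | succ t ih =>
    exact ih ((occupied_position h ha t).step_injective h (occupied_position h hb t) he)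

theorem position_eq_start (h : ∀ w, Done G r starts targets F w) {a : V} (ha : a ∈ starts)
    (t : ℕ) (ht : t ≤ F.s a) : position F.output a t = a := by
  induction t with
  | zero => rfl
  | succ t ih =>
    rw [position, ih (Nat.le_of_succ_le ht)]
    rcases stepPos_eq_or F.output a t with ⟨m, hm, rfl, rfl, -⟩ | ⟨-, hs⟩
    · have := (h m.src).s_le ha (Done.time_mem h hm)
      omega
    · exact hs

/-- Trace an entry of `l(x)` backwards: it is either the time until which a starting agent waits, or
an arrival whose move left at an entry one unit earlier. This is why every listed move is carried
out. -/
theorem exists_agent_at (h : ∀ w, Done G r starts targets F w) (t : ℕ) :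
    ∀ x, t ∈ F.l x → ∃ a ∈ starts, position F.output a t = x := by
  induction t with
  | zero =>
    intro x hx
    rw [(h x).arr] at hx
    rcases List.mem_append.1 hx with hx | hx
    · split_ifs at hx with hxs
      · exact ⟨x, hxs, rfl⟩
      · simp at hx
    · obtain ⟨m, -, -, hm⟩ := mem_arrivals.1 hx
      omega
  | succ t ih =>
    intro x hx
    rw [(h x).arr] at hx
    rcases List.mem_append.1 hx with hx | hx
    · split_ifs at hx with hxs
      · exact ⟨x, hxs, position_eq_start h hxs _ (List.mem_singleton.1 hx).le⟩
      · simp at hx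
    · obtain ⟨m, hm, rfl, hmt⟩ := mem_arrivals.1 hx
      obtain rfl : m.time = t := Nat.succ_injective hmt
      obtain ⟨a, ha, hpos⟩ := ih m.src (Done.time_mem h hm)
      refine ⟨a, ha, ?_⟩
      rw [position, hpos]
      exact stepPos_of_mem (fun m hm n hn => Done.move_unique h hm hn) hm

omit [Fintype V] [DecidableEq V] in
theorem FollowsDemand.adj {m : Move V} (h : FollowsDemand G r starts targets m) :
    G.Adj m.src m.dst := by
  rcases h with h | h
  · exact h.1.1.symm
  · exact h.1.1

omit [Fintype V] [DecidableEq V] in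
-- Opposite moves along an edge would make the demand of its lower end both negative and positive.
theorem FollowsDemand.not_opposite {m n : Move V} (hm : FollowsDemand G r starts targets m)
    (hn : FollowsDemand G r starts targets n) (h1 : m.src = n.dst) (h2 : n.src = m.dst) :
    False := by
  unfold FollowsDemand at hm hn
  rw [h1, ← h2] at hm
  rcases hm with ⟨⟨-, h⟩, hd⟩ | ⟨⟨-, h⟩, hd⟩ <;> rcases hn with ⟨⟨-, h'⟩, hd'⟩ | ⟨⟨-, h'⟩, hd'⟩ <;>
    omega

theorem nodup_output (h : ∀ w, Done G r starts targets F w) : F.output.Nodup := by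
  rw [List.nodup_iff_sublist]
  intro m hm
  have h1 := hm.filter fun n => decide (n.src = m.src)
  obtain ⟨rest, hr, -⟩ := (h m.src).out
  have hs := (h m.src).sorted
  rw [← hr] at hs
  -- A repeated move would repeat a time in a strictly increasing list.
  have h2 := (List.pairwise_append.1 hs).1.sublist (h1.map Move.time)
  simp at h2

theorem horizon_le (h : ∀ w, Done G r starts targets F w) : horizon F.output ≤ #targetsᶜ := by
  refine listMax_le (l := F.output.map fun m => m.time + 1) fun t ht => ?_
  obtain ⟨m, hm, rfl⟩ := List.mem_map.1 ht
  exact (h m.dst).bound _ (Done.time_succ_mem h hm)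

theorem isFeasible_output (h : ∀ w, Done G r starts targets F w) :
    IsFeasible G starts targets F.output where
  nodup := nodup_output h
  adj m hm := ((h m.src).dir m (mem_outMoves.2 ⟨hm, rfl⟩)).adj
  executed m hm := by
    obtain ⟨a, ha, hpos⟩ := exists_agent_at h m.time m.src (Done.time_mem h hm)
    refine ⟨a, ha, hpos, ?_⟩
    rw [position, hpos]
    exact stepPos_of_mem (fun m hm n hn => Done.move_unique h hm hn) hm
  no_vertex_conflict a ha b hb hne t he := hne (position_injective h ha hb t he)
  no_swap_conflict := by
    rintro a ha b hb hne t ⟨h1, h2⟩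
    have hpos : position F.output a t ≠ position F.output b t := fun he =>
      hne (position_injective h ha hb t he)
    rw [position] at h1 h2
    rcases stepPos_eq_or F.output (position F.output a t) t with
      ⟨m, hm, hms, -, hs⟩ | ⟨-, hs⟩
    · rcases stepPos_eq_or F.output (position F.output b t) t with
        ⟨n, hn, hns, -, hs'⟩ | ⟨-, hs'⟩
      · exact ((h m.src).dir m (mem_outMoves.2 ⟨hm, rfl⟩)).not_opposite
          ((h n.src).dir n (mem_outMoves.2 ⟨hn, rfl⟩))
          (by rw [hms, ← hs', h2]) (by rw [hns, ← hs, h1])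
      · exact hpos (by rw [← h2, hs'])
    · exact hpos (by rw [← h1, hs])
  reaches_target a ha := by
    rw [finalNode]
    rcases occupied_position h ha (horizon F.output) with ⟨hx, ht⟩ | ht | ⟨t₀, ht₀, -, hno⟩
    -- An agent still waiting to start has a departure time beyond the horizon, when no move is
    -- left; so this too is an entry at which nobody leaves, and its node is a target.
    · refine ((h _).stay ((h _).s_mem hx) fun m hm _ hmt => ?_).1
      have := time_lt_horizon hm
      omega
    · refine ((h _).stay ht fun m hm _ hmt => ?_).1
      have := time_lt_horizon hm
      omega
    · exact ((h _).stay ht₀ hno).1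

end Final

end TreeMAPF

theorem mainTheorem5 {V : Type*} [Fintype V] [DecidableEq V]
    (G : SimpleGraph V) (hG : G.IsTree) (r : V)
    (k : ℕ) (starts targets : Finset V) (hs : starts.card = k) (ht : targets.card = k)
    (χ : TreeMAPF.Choices G r) :
    TreeMAPF.IsFeasible G starts targets (TreeMAPF.directTrafficPlan G r starts targets χ) ∧
      TreeMAPF.sumOfCosts starts (TreeMAPF.directTrafficPlan G r starts targets χ) ≤
        k * (Fintype.card V - k) := by
  have h := TreeMAPF.done_directTraffic (targets := targets) hG (hs.trans ht.symm) χ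
  refine ⟨TreeMAPF.isFeasible_output h, ?_⟩
  rw [← ht, ← Finset.card_compl, ht, ← hs, ← smul_eq_mul]
  exact Finset.sum_le_card_nsmul _ _ _ fun a _ =>
    (TreeMAPF.pathLength_le _ a).trans (TreeMAPF.horizon_le h)
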